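/- Let $n$ be a natural number, $N=\mathbb{Z}^n/\mathbb{Z}e_{[n]}$ and $N_{\mathbb{R}}=\mathbb{R}^n/\mathbb{R}e_{[n]}$, where $e_{[n]}=(1,\dots,1)$. Let $\mathcal{B}(n)$ be the braid arrangement fan in $N_{\mathbb{R}}$, consisting of the Weyl chambers $\{x : x_{w(1)}\le\dots\le x_{w(n)}\}$, for $w$ a permutation of $[n]$, and all their faces. A fan is smooth if for each of its cones $\sigma$ the set $\sigma(1)$ of minimal lattice points of the rays of $\sigma$ extends to a $\mathbb{Z}$-basis of $N$. For a cone $\tau$ of a fan $\Sigma$, with $v_0=\sum_{v\in\tau(1)}v$, the star subdivision of $\Sigma$ relative to $\tau$ is $$\Sigma^*(\tau)=\{\sigma\in\Sigma : \tau\not\subseteq\sigma\}\cup\bigcup_{\tau\subseteq\sigma\in\Sigma}\{\mathrm{cone}(A) : A\subseteq\sigma(1)\cup\{v_0\},\ \tau(1)\not\subseteq A\}.$$ Let $\Sigma$ be a complete smooth fan in $N_{\mathbb{R}}$ that is refined by $\mathcal{B}(n)$. Then there is a finite sequence $(\Sigma_0,\Sigma_1,\dots,\Sigma_\ell)$ of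 complete smooth fans, each of them refined by $\mathcal{B}(n)$, such that $\Sigma_0=\Sigma$, $\Sigma_\ell=\mathcal{B}(n)$ and, for each $1\le i\le\ell$, $\Sigma_i=\Sigma_{i-1}^*(\tau)$ for some cone $\tau\in\Sigma_{i-1}$ of the following form: there are $k\ge 2$ and a partition of $[n]$ into nonempty sets $A_1,\dots,A_k,B$ such that either $$\tau=\{x : x_a\le x_b \text{ for } a\in A_l,\ b\in B,\ 1\le l\le k,\ \text{and } x \text{ is constant on each of } A_1,\dots,A_k,B\},$$ or $\tau$ is given by the same conditions with the inequalities reversed, $x_b\le x_a$. That is, the preposet of $\tau$ is a star of down-sets $A_1,\dots,A_k$ below an up-set $B$, or the opposite of such a star. -/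

import Mathlib

namespace BraidFan

/-- The real vector space `N_ℝ = ℝⁿ / ℝ e_[n]`, where `e_[n] = (1, …, 1)`. -/
abbrev NR (n : ℕ) : Type :=
  (Fin n → ℝ) ⧸ Submodule.span ℝ {(1 : Fin n → ℝ)}

/-- The class in `N_ℝ` of a vector of `ℝⁿ`. -/
abbrev toNR {n : ℕ} (x : Fin n → ℝ) : NR n :=
  Submodule.Quotient.mk x

/-- The lattice `N = ℤⁿ / ℤ e_[n]` inside `N_ℝ`: the subgroup generated by the classes of the
standard basis vectors. -/
def lattice (n : ℕ) : Submodule ℤ (NR n) :=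
  Submodule.span ℤ (Set.range fun i : Fin n => toNR (Pi.single i (1 : ℝ)))

/-- The linear functional `x ↦ x_j - x_i` on `N_ℝ`. -/
def coordDiff {n : ℕ} (i j : Fin n) : NR n →ₗ[ℝ] ℝ :=
  Submodule.liftQ _ ((LinearMap.proj j : (Fin n → ℝ) →ₗ[ℝ] ℝ) - LinearMap.proj i) (by
    rw [Submodule.span_le]
    simp)

theorem coordDiff_toNR {n : ℕ} (i j : Fin n) (x : Fin n → ℝ) :
    coordDiff i j (toNR x) = x j - x i := by
  simp [coordDiff, toNR]

/-! ### Cones and fans -/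

/-- Cones in `N_ℝ`. -/
abbrev Cone (n : ℕ) : Type := PointedCone ℝ (NR n)

/-- A rational polyhedral cone: `cone(A)` for a finite set `A` of lattice vectors. -/
def IsRationalPolyhedral {n : ℕ} (σ : Cone n) : Prop :=
  ∃ A : Set (NR n), A.Finite ∧ A ⊆ lattice n ∧ σ = PointedCone.hull ℝ A

/-- A strongly convex cone: it contains no line. -/
def IsStronglyConvex {n : ℕ} (σ : Cone n) : Prop :=
  ∀ x ∈ σ, -x ∈ σ → x = 0

/-- A fan in `N_ℝ`: a finite set of strongly convex rational polyhedral cones that is closed under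
taking faces and in which any two cones meet in a common face. -/
structure IsFan {n : ℕ} (F : Set (Cone n)) : Prop where
  finite : F.Finite
  rational : ∀ σ ∈ F, IsRationalPolyhedral σ
  stronglyConvex : ∀ σ ∈ F, IsStronglyConvex σ
  face_mem : ∀ σ ∈ F, ∀ τ : Cone n, τ.IsFaceOf σ → τ ∈ F
  inter_face : ∀ σ ∈ F, ∀ τ ∈ F, (σ ⊓ τ).IsFaceOf σ ∧ (σ ⊓ τ).IsFaceOf τ

/-- The support of a set of cones: the union of its members. -/
def support {n : ℕ} (F : Set (Cone n)) : Set (NR n) :=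
  {x | ∃ σ ∈ F, x ∈ σ}

/-- A fan is complete when its support is all of `N_ℝ`. -/
def IsCompleteFan {n : ℕ} (F : Set (Cone n)) : Prop :=
  support F = Set.univ

/-- `F` is refined by `G`: the supports agree and each cone of `G` lies in a cone of `F`. -/
def IsRefinedBy {n : ℕ} (F G : Set (Cone n)) : Prop :=
  support F = support G ∧ ∀ ρ ∈ G, ∃ σ ∈ F, ρ ≤ σ

/-- `σ(1)`: the set of minimal lattice points of the rays (one-dimensional faces) of `σ`. -/
def rayGens {n : ℕ} (σ : Cone n) : Set (NR n) :=
  {v | v ∈ lattice n ∧ v ≠ 0 ∧ (∀ t : ℝ, 0 < t → t < 1 → t • v ∉ lattice n) ∧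
    (PointedCone.hull ℝ {v}).IsFaceOf σ}

/-- A cone is smooth when `σ(1)` can be extended to a `ℤ`-basis of the lattice `N`. -/
def IsSmoothCone {n : ℕ} (σ : Cone n) : Prop :=
  ∃ S : Set (NR n), rayGens σ ⊆ S ∧ LinearIndepOn ℤ id S ∧ Submodule.span ℤ S = lattice n

/-- A fan is smooth when each of its cones is. -/
def IsSmooth {n : ℕ} (F : Set (Cone n)) : Prop :=
  ∀ σ ∈ F, IsSmoothCone σ

/-! ### Star subdivisions -/

/-- `v₀`, the sum of the elements of `τ(1)` (a finite set for every polyhedral cone `τ`). -/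
noncomputable def rayGenSum {n : ℕ} (τ : Cone n) : NR n :=
  ∑ᶠ v ∈ rayGens τ, v

/-- The star subdivision of the cone `σ` relative to its face `τ`:
all `cone(A)` with `A ⊆ σ(1) ∪ {v₀}` and `τ(1) ⊄ A`. -/
def starSubdivisionCone {n : ℕ} (σ τ : Cone n) : Set (Cone n) :=
  {ρ | ∃ A : Set (NR n), A ⊆ rayGens σ ∪ {rayGenSum τ} ∧ ¬ rayGens τ ⊆ A ∧
    ρ = PointedCone.hull ℝ A}

/-- The star subdivision of the fan `F` relative to `τ ∈ F`: the cones of `F` that do not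
contain `τ`, together with the star subdivisions of those that do. -/
def starSubdivision {n : ℕ} (F : Set (Cone n)) (τ : Cone n) : Set (Cone n) :=
  {σ | σ ∈ F ∧ ¬ τ ≤ σ} ∪ ⋃ σ ∈ {σ | σ ∈ F ∧ τ ≤ σ}, starSubdivisionCone σ τ

/-! ### Preposets and the braid arrangement fan -/

/-- The cone labeled by a preposet `r` on `[n]`: all `x` with `x_i ≤ x_j` whenever `r i j`. -/
def preposetCone {n : ℕ} (r : Fin n → Fin n → Prop) : Cone n where
  carrier := {x | ∀ i j, r i j → 0 ≤ coordDiff i j x}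
  zero_mem' := fun i j _ => by simp
  add_mem' := fun hx hy i j h => by
    rw [map_add]
    exact add_nonneg (hx i j h) (hy i j h)
  smul_mem' := fun c x hx i j h => by
    have h1 : coordDiff i j (c • x) = (c : ℝ) * coordDiff i j x :=
      (coordDiff i j).map_smul (c : ℝ) x
    rw [h1]
    exact mul_nonneg c.2 (hx i j h)

theorem toNR_mem_preposetCone {n : ℕ} (r : Fin n → Fin n → Prop) (x : Fin n → ℝ) :
    toNR x ∈ preposetCone r ↔ ∀ i j, r i j → x i ≤ x j := by
  change (∀ i j, r i j → 0 ≤ coordDiff i j (toNR x)) ↔ _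
  simp [coordDiff_toNR]

/-- The Weyl chamber of the linear order on `[n]` in which `i` has position `w i`. -/
def weylChamber {n : ℕ} (w : Equiv.Perm (Fin n)) : Cone n :=
  preposetCone fun i j => w i ≤ w j

/-- The braid arrangement fan `B(n)`: the Weyl chambers of type `A_{n-1}` and all their faces. -/
def braidFan (n : ℕ) : Set (Cone n) :=
  {τ | ∃ w : Equiv.Perm (Fin n), τ.IsFaceOf (weylChamber w)}

/-- The nonempty sets `A_1, …, A_k, B` partition `[n]`. -/
structure IsStarPartition {n k : ℕ} (A : Fin k → Finset (Fin n)) (B : Finset (Fin n)) : Prop where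
  leaf_nonempty : ∀ l, (A l).Nonempty
  center_nonempty : B.Nonempty
  leaf_disjoint : ∀ l m, l ≠ m → Disjoint (A l) (A m)
  center_disjoint : ∀ l, Disjoint (A l) B
  cover : ∀ i, i ∈ B ∨ ∃ l, i ∈ A l

/-- The star preposet whose equivalence classes are `A_1, …, A_k, B` and whose Hasse diagram has
the edges `A_l → B`: each `A_l` is a down-set, and lies below the up-set `B`. -/
def starPreposet {n k : ℕ} (A : Fin k → Finset (Fin n)) (B : Finset (Fin n)) :
    Fin n → Fin n → Prop :=
  fun i j => (i ∈ B ∧ j ∈ B) ∨ ∃ l, i ∈ A l ∧ (j ∈ A l ∨ j ∈ B)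

/-- `τ` is labeled by a star preposet with at least two leaves, or by the opposite of one. -/
def IsStarLabeled {n : ℕ} (τ : Cone n) : Prop :=
  ∃ (k : ℕ) (A : Fin k → Finset (Fin n)) (B : Finset (Fin n)),
    2 ≤ k ∧ IsStarPartition A B ∧
      (τ = preposetCone (starPreposet A B) ∨
        τ = preposetCone (fun i j => starPreposet A B j i))

end BraidFan

open BraidFan

namespace BraidFan

variable {n : ℕ}

/-! ### Coordinates on `N_ℝ` -/

/-! The given fan is first turned into combinatorics. A point `y` whose coordinates are ordered like
those of `x`, up to more ties, is a summand of a multiple of `x` inside one Weyl chamber; by the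
face axioms every cone containing `x` contains `y` (`IsFan.mem_of_coarsens`). As `x` is a
nonnegative combination of indicators coarsening it, every cone is generated by indicators of proper
nonempty subsets of `[n]`, and the fan becomes a simplicial complex `D` of families of subsets
(`exists_isCoarse`). In `IsCoarse`, uniqueness of coefficients across two faces encodes both
simpliciality and intersection along common faces. Smoothness need not be carried along: in a
full-dimensional cone the coordinate dual to a ray is a difference `x_b - x_a` (`exists_dual`), so
unimodularity is automatic (`isSmooth`).

If all faces of `D` are chains, the fan is the braid fan (`fanOf_eq_braidFan`). Otherwise some face
contains two non-nested sets, which by `cross_free` are disjoint or cover `[n]`. Among all disjoint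
pairs in faces of `D`, take one with largest union; among covering pairs, one with smallest
intersection. Extremality forces the differences dual to `S` and `T` to share an endpoint, in every
full-dimensional cone containing both. The wall where the two coefficients agree then lies on a
hyperplane `x_p = x_q`, so subdividing at `cone(S, T)` cuts no chamber (`chamber_le_of_dual`) and
the result is again refined by the braid fan. The new ray is `S ∪ T` or `S ∩ T`, a subset not yet a
vertex, so the process stops. Stars with two leaves suffice. -/

theorem eq_of_coordDiff_eq {x y : NR n} (h : ∀ i j, coordDiff i j x = coordDiff i j y) :
    x = y := by
  induction x using Submodule.Quotient.induction_on with | _ x => ?_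
  induction y using Submodule.Quotient.induction_on with | _ y => ?_
  rw [Submodule.Quotient.eq, Submodule.mem_span_singleton]
  rcases isEmpty_or_nonempty (Fin n) with hn | ⟨⟨k⟩⟩
  · exact ⟨0, Subsingleton.elim _ _⟩
  · refine ⟨x k - y k, funext fun i => ?_⟩
    have := h k i
    rw [← toNR, ← toNR, coordDiff_toNR, coordDiff_toNR] at this
    simp only [Pi.smul_apply, Pi.one_apply, smul_eq_mul, mul_one, Pi.sub_apply]
    linarith

theorem coordDiff_swap (i j : Fin n) (x : NR n) : coordDiff i j x = -coordDiff j i x := by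
  induction x using Submodule.Quotient.induction_on with | _ x => ?_
  rw [← toNR, coordDiff_toNR, coordDiff_toNR]; ring

theorem coordDiff_add_coordDiff (i j k : Fin n) (x : NR n) :
    coordDiff i j x + coordDiff j k x = coordDiff i k x := by
  induction x using Submodule.Quotient.induction_on with | _ x => ?_
  rw [← toNR, coordDiff_toNR, coordDiff_toNR, coordDiff_toNR]; ring

/-- The class in `N_ℝ` of the indicator vector of `S`. -/
noncomputable def ind (S : Finset (Fin n)) : NR n :=
  toNR fun i => if i ∈ S then 1 else 0

theorem coordDiff_ind (i j : Fin n) (S : Finset (Fin n)) :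
    coordDiff i j (ind S) = (if j ∈ S then 1 else 0) - (if i ∈ S then 1 else 0) :=
  coordDiff_toNR ..

/-- Neither empty nor everything. -/
def IsProper (S : Finset (Fin n)) : Prop :=
  (∃ j, j ∈ S) ∧ ∃ i, i ∉ S

theorem IsProper.ind_ne_zero {S : Finset (Fin n)} (hS : IsProper S) : ind S ≠ 0 := by
  obtain ⟨⟨j, hj⟩, i, hi⟩ := hS
  intro h
  have := coordDiff_ind i j S
  simp [h, hi, hj] at this

theorem IsProper.ind_injective {S T : Finset (Fin n)} (hS : IsProper S) (hT : IsProper T)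
    {c : ℝ} (hc : 0 < c) (h : ind S = c • ind T) : S = T := by
  obtain ⟨⟨j, hj⟩, i, hi⟩ := hS
  obtain ⟨⟨j', hj'⟩, i', hi'⟩ := hT
  have key : ∀ a b, coordDiff a b (ind S) = c * coordDiff a b (ind T) := fun a b => by
    rw [h, map_smul, smul_eq_mul]
  have e1 := key i j
  simp only [coordDiff_ind, hi, hj, if_true, if_false] at e1
  have hjT : j ∈ T := by
    by_contra hn
    simp only [hn, if_false] at e1
    split_ifs at e1 <;> linarith
  have hiT : i ∉ T := by
    intro hn
    simp only [hn, hjT, if_true] at e1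
    linarith
  ext k
  have e2 := key i k
  simp only [coordDiff_ind, hi, hiT, if_false] at e2
  split_ifs at e2 with h1 h2 <;> first | tauto | (exfalso; linarith)

theorem ind_mem_lattice (S : Finset (Fin n)) : ind S ∈ lattice n := by
  have : ind S = ∑ i ∈ S, toNR (Pi.single i (1 : ℝ)) := by
    refine eq_of_coordDiff_eq fun i j => ?_
    simp [coordDiff_ind, coordDiff_toNR, map_sum, Pi.single_apply]
  rw [this]
  exact Submodule.sum_mem _ fun i _ => Submodule.subset_span ⟨i, rfl⟩

theorem exists_int_coordDiff {x : NR n} (hx : x ∈ lattice n) (i j : Fin n) :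
    ∃ m : ℤ, coordDiff i j x = m := by
  induction hx using Submodule.span_induction with
  | mem x h =>
    obtain ⟨k, rfl⟩ := h
    refine ⟨(if j = k then 1 else 0) - (if i = k then 1 else 0), ?_⟩
    simp [coordDiff_toNR, Pi.single_apply]
  | zero => exact ⟨0, by simp⟩
  | add x y _ _ hx hy =>
    obtain ⟨a, ha⟩ := hx
    obtain ⟨b, hb⟩ := hy
    exact ⟨a + b, by simp [ha, hb]⟩
  | smul m x _ hx =>
    obtain ⟨a, ha⟩ := hx
    exact ⟨m * a, by simp [ha]⟩

theorem IsProper.smul_ind_notMem_lattice {S : Finset (Fin n)} (hS : IsProper S) {t : ℝ}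
    (h0 : 0 < t) (h1 : t < 1) : t • ind S ∉ lattice n := by
  obtain ⟨⟨j, hj⟩, i, hi⟩ := hS
  intro h
  obtain ⟨m, hm⟩ := exists_int_coordDiff h i j
  simp only [map_smul, coordDiff_ind, hi, hj, if_true, if_false, smul_eq_mul, sub_zero,
    mul_one] at hm
  subst hm
  have h0' : (0 : ℤ) < m := by exact_mod_cast h0
  have h1' : m < (1 : ℤ) := by exact_mod_cast h1
  omega

/-! ### Nonnegative combinations of indicators -/

/-- The linear combination of the vectors `ind S` with coefficients `f S`. -/
noncomputable def comb (f : Finset (Fin n) → ℝ) : NR n :=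
  ∑ S, f S • ind S

theorem comb_add (f g : Finset (Fin n) → ℝ) : comb (f + g) = comb f + comb g := by
  simp [comb, add_smul, Finset.sum_add_distrib]

theorem comb_smul (c : ℝ) (f : Finset (Fin n) → ℝ) : comb (c • f) = c • comb f := by
  simp [comb, mul_smul, Finset.smul_sum]

@[simp] theorem comb_zero : comb (0 : Finset (Fin n) → ℝ) = 0 := by simp [comb]

@[simp] theorem comb_single (S : Finset (Fin n)) (c : ℝ) :
    comb (Pi.single S c) = c • ind S := by
  rw [comb, Finset.sum_eq_single S]
  · simp
  · intro T _ h
    simp [Pi.single_eq_of_ne h]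
  · simp

theorem coordDiff_comb (i j : Fin n) (f : Finset (Fin n) → ℝ) :
    coordDiff i j (comb f) = ∑ S, f S * coordDiff i j (ind S) := by
  simp [comb, map_sum]

/-- The cone generated by the vectors `ind S`, for `S ∈ A`. -/
noncomputable def coneOf (A : Finset (Finset (Fin n))) : Cone n :=
  PointedCone.hull ℝ (ind '' (A : Set (Finset (Fin n))))

/-- Coefficient functions that are nonnegative and vanish outside `A`. -/
structure IsCoeff (A : Finset (Finset (Fin n))) (f : Finset (Fin n) → ℝ) : Prop where
  nonneg : ∀ S, 0 ≤ f S
  eq_zero : ∀ S, S ∉ A → f S = 0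

theorem IsCoeff.mono {A B : Finset (Finset (Fin n))} {f : Finset (Fin n) → ℝ} (h : IsCoeff A f)
    (hAB : A ⊆ B) : IsCoeff B f :=
  ⟨h.nonneg, fun S hS => h.eq_zero S fun h' => hS (hAB h')⟩

theorem IsCoeff.add {A : Finset (Finset (Fin n))} {f g : Finset (Fin n) → ℝ} (hf : IsCoeff A f)
    (hg : IsCoeff A g) : IsCoeff A (f + g) :=
  ⟨fun S => add_nonneg (hf.nonneg S) (hg.nonneg S), fun S hS => by
    simp [hf.eq_zero S hS, hg.eq_zero S hS]⟩

theorem IsCoeff.smul {A : Finset (Finset (Fin n))} {f : Finset (Fin n) → ℝ} (hf : IsCoeff A f)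
    {c : ℝ} (hc : 0 ≤ c) : IsCoeff A (c • f) :=
  ⟨fun S => mul_nonneg hc (hf.nonneg S), fun S hS => by simp [hf.eq_zero S hS]⟩

theorem isCoeff_zero (A : Finset (Finset (Fin n))) : IsCoeff A 0 :=
  ⟨fun _ => le_rfl, fun _ _ => rfl⟩

theorem isCoeff_single {A : Finset (Finset (Fin n))} {S : Finset (Fin n)} (hS : S ∈ A)
    {c : ℝ} (hc : 0 ≤ c) : IsCoeff A (Pi.single S c) := by
  refine ⟨fun T => ?_, fun T hT => ?_⟩
  · rw [Pi.single_apply]; split_ifs <;> simp [hc]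
  · rw [Pi.single_eq_of_ne]; rintro rfl; exact hT hS

theorem IsCoeff.mem_of_ne_zero {A : Finset (Finset (Fin n))} {f : Finset (Fin n) → ℝ}
    (h : IsCoeff A f) {S : Finset (Fin n)} (hS : f S ≠ 0) : S ∈ A := by
  by_contra h'
  exact hS (h.eq_zero S h')

theorem comb_mem {σ : Cone n} {f : Finset (Fin n) → ℝ} (h0 : ∀ S, 0 ≤ f S)
    (h : ∀ S, f S ≠ 0 → ind S ∈ σ) : comb f ∈ σ := by
  refine Submodule.sum_mem _ fun S _ => ?_
  by_cases hS : f S = 0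
  · simp [hS]
  · exact PointedCone.smul_mem σ (h0 S) (h S hS)

theorem ind_mem_coneOf {A : Finset (Finset (Fin n))} {S : Finset (Fin n)} (hS : S ∈ A) :
    ind S ∈ coneOf A :=
  Submodule.subset_span ⟨S, hS, rfl⟩

theorem mem_coneOf {A : Finset (Finset (Fin n))} {x : NR n} :
    x ∈ coneOf A ↔ ∃ f, IsCoeff A f ∧ comb f = x := by
  constructor
  · intro h
    induction h using Submodule.span_induction with
    | mem x h =>
      obtain ⟨S, hS, rfl⟩ := h
      exact ⟨Pi.single S 1, isCoeff_single hS zero_le_one, by simp⟩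
    | zero => exact ⟨0, isCoeff_zero A, by simp⟩
    | add x y _ _ hx hy =>
      obtain ⟨f, hf, rfl⟩ := hx
      obtain ⟨g, hg, rfl⟩ := hy
      exact ⟨f + g, hf.add hg, comb_add f g⟩
    | smul c x _ hx =>
      obtain ⟨f, hf, rfl⟩ := hx
      exact ⟨(c : ℝ) • f, hf.smul c.2, comb_smul _ f⟩
  · rintro ⟨f, hf, rfl⟩
    exact comb_mem hf.nonneg fun S hS => ind_mem_coneOf (hf.mem_of_ne_zero hS)

theorem coneOf_le {A : Finset (Finset (Fin n))} {σ : Cone n} :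
    coneOf A ≤ σ ↔ ∀ S ∈ A, ind S ∈ σ := by
  rw [coneOf, Submodule.span_le, Set.image_subset_iff]
  rfl

theorem coneOf_mono {A B : Finset (Finset (Fin n))} (h : A ⊆ B) : coneOf A ≤ coneOf B :=
  coneOf_le.2 fun _ hS => ind_mem_coneOf (h hS)

/-! ### Coarsenings -/

/-- The coordinates of `y` are weakly ordered in the same way as those of `x`, possibly with more
ties. -/
def Coarsens (y x : NR n) : Prop :=
  ∀ i j, 0 ≤ coordDiff i j x → 0 ≤ coordDiff i j y

theorem exists_mem_weylChamber (x : NR n) : ∃ w, x ∈ weylChamber w := by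
  induction x using Submodule.Quotient.induction_on with | _ x => ?_
  refine ⟨(Tuple.sort x)⁻¹, (toNR_mem_preposetCone _ _).2 fun i j h => ?_⟩
  simpa using Tuple.monotone_sort x h

theorem Coarsens.mem_weylChamber {x y : NR n} (h : Coarsens y x) {w : Equiv.Perm (Fin n)}
    (hx : x ∈ weylChamber w) : y ∈ weylChamber w :=
  fun i j hij => h i j (hx i j hij)

/-- `M` bounds the finitely many ratios of coordinate differences of `y` to those of `x`; where `x`
has a tie, so has `y`. -/
theorem Coarsens.exists_pos {x y : NR n} (h : Coarsens y x) :
    ∃ M : ℝ, 0 < M ∧ Coarsens (M • x - y) x := by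
  obtain ⟨M, hM⟩ := (Set.finite_range fun p : Fin n × Fin n =>
    coordDiff p.1 p.2 y / coordDiff p.1 p.2 x).bddAbove
  refine ⟨max M 1, by positivity, fun i j hij => ?_⟩
  rw [map_sub, map_smul, smul_eq_mul, sub_nonneg]
  rcases hij.eq_or_lt with h0 | h0
  · have h1 := h i j hij
    have h2 := h j i (by rw [coordDiff_swap, ← h0, neg_zero])
    rw [coordDiff_swap] at h2
    rw [← h0]
    linarith
  · have := hM ⟨(i, j), rfl⟩
    simp only [div_le_iff₀ h0] at this
    exact this.trans (mul_le_mul_of_nonneg_right (le_max_left _ _) hij)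

/-- Every point is a nonnegative combination of indicators that coarsen it. -/
theorem exists_comb_coarsens (x : NR n) :
    ∃ f, (∀ S, 0 ≤ f S) ∧ (∀ S, f S ≠ 0 → IsProper S ∧ Coarsens (ind S) x) ∧ comb f = x := by
  classical
  induction x using Submodule.Quotient.induction_on with | _ x => ?_
  induction hk : (Finset.univ.image x).card using Nat.strong_induction_on generalizing x with
  | _ k ih => ?_
  by_cases hconst : ∀ i j, x i ≤ x j
  · refine ⟨0, fun _ => le_rfl, fun S h => absurd rfl h, eq_of_coordDiff_eq fun i j => ?_⟩
    rw [← toNR, coordDiff_toNR, le_antisymm (hconst i j) (hconst j i)]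
    simp
  push Not at hconst
  obtain ⟨a, b, hab⟩ := hconst
  obtain ⟨p, -, hp⟩ := Finset.exists_min_image Finset.univ x ⟨a, Finset.mem_univ _⟩
  obtain ⟨q, hq, hq'⟩ := Finset.exists_min_image (Finset.univ.filter fun i => x p < x i) x
    ⟨a, by simpa using (hp b (Finset.mem_univ _)).trans_lt hab⟩
  simp only [Finset.mem_filter, Finset.mem_univ, true_and] at hq hq' hp
  have hp : ∀ i, x p ≤ x i := fun i => hp i trivial
  -- The minimal value `x p` is raised to the next value `x q`, which leaves one value fewer. Modulo
  -- constants this costs `x q - x p` times the indicator of the non-minimal positions.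
  set x' : Fin n → ℝ := fun i => max (x i) (x q) with hx'
  set S : Finset (Fin n) := Finset.univ.filter fun i => x p < x i with hS
  have hcard : (Finset.univ.image x').card < k := by
    rw [← hk]
    refine Finset.card_lt_card (Finset.ssubset_iff_of_subset ?_ |>.2 ⟨x p, ?_, ?_⟩)
    · intro y hy
      simp only [Finset.mem_image, Finset.mem_univ, true_and] at hy ⊢
      obtain ⟨i, rfl⟩ := hy
      rcases max_choice (x i) (x q) with h | h
      · exact ⟨i, h.symm⟩
      · exact ⟨q, h.symm⟩
    · simp
    · simp only [Finset.mem_image, Finset.mem_univ, true_and, not_exists, hx']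
      intro i h
      have := le_max_right (x i) (x q)
      linarith
  obtain ⟨f, hf0, hf, hfx⟩ := ih _ hcard x' rfl
  have hcoarse : Coarsens (toNR x') (toNR x) := fun i j h => by
    rw [coordDiff_toNR] at h ⊢
    exact sub_nonneg.2 (max_le_max_right _ (sub_nonneg.1 h))
  refine ⟨f + Pi.single S (x q - x p), fun T => add_nonneg (hf0 T) ?_, fun T hT => ?_, ?_⟩
  · rw [Pi.single_apply]; split_ifs <;> linarith
  · by_cases hTS : T = S
    · subst hTS
      refine ⟨⟨⟨q, by simpa [hS] using hq⟩, p, by simp [hS]⟩, fun i j h => ?_⟩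
      rw [← toNR, coordDiff_toNR] at h
      rw [coordDiff_ind]
      simp only [hS, Finset.mem_filter, Finset.mem_univ, true_and]
      split_ifs <;> linarith
    · rw [Pi.add_apply, Pi.single_eq_of_ne hTS, add_zero] at hT
      exact ⟨(hf T hT).1, fun i j h => (hf T hT).2 i j (hcoarse i j h)⟩
  · rw [comb_add, comb_single, hfx]
    refine eq_of_coordDiff_eq fun i j => ?_
    have key : ∀ i, x i = x' i + (x q - x p) * (if i ∈ S then 1 else 0) - (x q - x p) := by
      intro i
      simp only [hS, hx', Finset.mem_filter, Finset.mem_univ, true_and]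
      split_ifs with h
      · rw [max_eq_left (hq' i h)]; ring
      · have : x i = x p := le_antisymm (not_lt.1 h) (hp i)
        rw [max_eq_right (by linarith)]; linarith
    rw [map_add, map_smul, coordDiff_ind, ← toNR, ← toNR, coordDiff_toNR, coordDiff_toNR, key i,
      key j, smul_eq_mul]
    ring

theorem weylChamber_mem_braidFan (w : Equiv.Perm (Fin n)) : weylChamber w ∈ braidFan n :=
  ⟨w, PointedCone.IsFaceOf.refl _⟩

theorem support_braidFan : support (braidFan n) = Set.univ :=
  Set.eq_univ_of_forall fun x =>
    let ⟨w, hw⟩ := exists_mem_weylChamber x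
    ⟨_, weylChamber_mem_braidFan w, hw⟩

/-- The cones of a fan that is refined by the braid arrangement fan are closed under coarsening. -/
theorem IsFan.mem_of_coarsens {F : Set (Cone n)} (hF : IsFan F)
    (href : ∀ ρ ∈ braidFan n, ∃ σ ∈ F, ρ ≤ σ) {σ : Cone n} (hσ : σ ∈ F) {x y : NR n}
    (hx : x ∈ σ) (hyx : Coarsens y x) : y ∈ σ := by
  obtain ⟨w, hw⟩ := exists_mem_weylChamber x
  obtain ⟨σ', hσ', hle⟩ := href _ (weylChamber_mem_braidFan w)
  -- Both `y` and `M x - y` lie in the chamber, hence in `σ'`; their sum `M x` lies in `σ ⊓ σ'`, a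
  -- face of `σ'`, so the summand `y` does too.
  obtain ⟨M, hM, hMy⟩ := hyx.exists_pos
  have hface := (hF.inter_face σ hσ σ' hσ').2
  refine (hface.mem_of_add_mem_left (hle (hyx.mem_weylChamber hw))
    (hle (hMy.mem_weylChamber hw)) ?_).1
  rw [add_sub_cancel]
  exact PointedCone.smul_mem _ hM.le ⟨hx, hle hw⟩

/-! ### Simplicial fans with rays spanned by indicators -/

/-- A simplicial complex on the proper nonempty subsets of `[n]` whose faces span the cones of a
complete simplicial fan refined by the braid arrangement fan. -/
structure IsCoarse (D : Set (Finset (Finset (Fin n)))) : Prop where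
  down_closed : ∀ A ∈ D, ∀ B ⊆ A, B ∈ D
  proper : ∀ A ∈ D, ∀ S ∈ A, IsProper S
  coeff_unique : ∀ A ∈ D, ∀ B ∈ D, ∀ f g, IsCoeff A f → IsCoeff B g → comb f = comb g → f = g
  chamber_le : ∀ w, ∃ A ∈ D, weylChamber w ≤ coneOf A

/-- The set of cones spanned by the members of `D`. -/
def fanOf (D : Set (Finset (Finset (Fin n)))) : Set (Cone n) :=
  coneOf '' D

namespace IsCoarse

variable {D : Set (Finset (Finset (Fin n)))}

theorem ind_injOn (hD : IsCoarse D) {A B : Finset (Finset (Fin n))} (hA : A ∈ D) (hB : B ∈ D)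
    {S T : Finset (Fin n)} (hS : S ∈ A) (hT : T ∈ B) {c : ℝ} (hc : 0 < c)
    (h : ind S = c • ind T) : S = T :=
  (hD.proper A hA S hS).ind_injective (hD.proper B hB T hT) hc h

theorem mem_of_ind_mem (hD : IsCoarse D) {A B : Finset (Finset (Fin n))} (hA : A ∈ D)
    (hB : B ∈ D) {S : Finset (Fin n)} (hS : S ∈ A) (h : ind S ∈ coneOf B) : S ∈ B := by
  obtain ⟨g, hg, hgS⟩ := mem_coneOf.1 h
  have := hD.coeff_unique A hA B hB _ g (isCoeff_single hS zero_le_one) hg (by simp [hgS])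
  apply hg.mem_of_ne_zero
  simp [← this]

theorem coneOf_le_coneOf (hD : IsCoarse D) {A B : Finset (Finset (Fin n))} (hA : A ∈ D)
    (hB : B ∈ D) : coneOf A ≤ coneOf B ↔ A ⊆ B :=
  ⟨fun h _ hS => hD.mem_of_ind_mem hA hB hS (h (ind_mem_coneOf hS)), coneOf_mono⟩

theorem isFaceOf (hD : IsCoarse D) {A B : Finset (Finset (Fin n))} (hA : A ∈ D) (hBA : B ⊆ A) :
    (coneOf B).IsFaceOf (coneOf A) := by
  refine .of_mem_of_add_mem_left (coneOf_mono hBA) fun {x y} hx hy hxy => ?_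
  obtain ⟨f, hf, rfl⟩ := mem_coneOf.1 hx
  obtain ⟨g, hg, rfl⟩ := mem_coneOf.1 hy
  obtain ⟨k, hk, hkx⟩ := mem_coneOf.1 hxy
  have := hD.coeff_unique A hA B (hD.down_closed A hA B hBA) _ k (hf.add hg) hk
    (by rw [comb_add, hkx])
  refine mem_coneOf.2 ⟨f, ⟨hf.nonneg, fun S hS => ?_⟩, rfl⟩
  have h1 := congrFun this S
  rw [hk.eq_zero S hS, Pi.add_apply] at h1
  linarith [hf.nonneg S, hg.nonneg S]

/-- A face contains every generator occurring with positive coefficient in one of its points. -/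
theorem eq_coneOf_of_isFaceOf {A : Finset (Finset (Fin n))} {τ : Cone n}
    (hτ : τ.IsFaceOf (coneOf A)) : ∃ B ⊆ A, τ = coneOf B := by
  classical
  refine ⟨A.filter fun S => ind S ∈ τ, Finset.filter_subset _ _, le_antisymm (fun x hx => ?_)
    (coneOf_le.2 fun S hS => (Finset.mem_filter.1 hS).2)⟩
  obtain ⟨f, hf, rfl⟩ := mem_coneOf.1 (hτ.le hx)
  refine comb_mem hf.nonneg fun S hS => ind_mem_coneOf ?_
  have hSA := hf.mem_of_ne_zero hS
  refine Finset.mem_filter.2 ⟨hSA, ?_⟩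
  rw [comb, ← Finset.add_sum_erase _ _ (Finset.mem_univ S)] at hx
  refine hτ.mem_of_smul_add_mem (ind_mem_coneOf hSA) (Submodule.sum_mem _ fun T _ => ?_)
    ((hf.nonneg S).lt_of_ne' hS) hx
  by_cases hT : f T = 0
  · simp [hT]
  · exact PointedCone.smul_mem _ (hf.nonneg T) (ind_mem_coneOf (hf.mem_of_ne_zero hT))

theorem inf_coneOf (hD : IsCoarse D) {A B : Finset (Finset (Fin n))} (hA : A ∈ D) (hB : B ∈ D) :
    coneOf A ⊓ coneOf B = coneOf (A ∩ B) := by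
  refine le_antisymm (fun x hx => ?_) (le_inf (coneOf_mono Finset.inter_subset_left)
    (coneOf_mono Finset.inter_subset_right))
  obtain ⟨f, hf, rfl⟩ := mem_coneOf.1 hx.1
  obtain ⟨g, hg, hgf⟩ := mem_coneOf.1 hx.2
  obtain rfl := hD.coeff_unique A hA B hB f g hf hg hgf.symm
  exact comb_mem hf.nonneg fun S hS => ind_mem_coneOf
    (Finset.mem_inter.2 ⟨hf.mem_of_ne_zero hS, hg.mem_of_ne_zero hS⟩)

theorem stronglyConvex (hD : IsCoarse D) {A : Finset (Finset (Fin n))} (hA : A ∈ D) :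
    IsStronglyConvex (coneOf A) := by
  intro x hx hx'
  obtain ⟨f, hf, rfl⟩ := mem_coneOf.1 hx
  obtain ⟨g, hg, hgf⟩ := mem_coneOf.1 hx'
  have := hD.coeff_unique A hA A hA _ 0 (hf.add hg) (isCoeff_zero A) (by simp [comb_add, hgf])
  have hf0 : f = 0 := by
    funext S
    have := congrFun this S
    simp only [Pi.add_apply, Pi.zero_apply] at this ⊢
    linarith [hf.nonneg S, hg.nonneg S]
  simp [hf0]

theorem isFan (hD : IsCoarse D) : IsFan (fanOf D) where
  finite := (Set.toFinite D).image _
  rational := by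
    rintro _ ⟨A, -, rfl⟩
    refine ⟨_, (Set.toFinite (A : Set (Finset (Fin n)))).image ind, ?_, rfl⟩
    rintro _ ⟨S, -, rfl⟩
    exact ind_mem_lattice S
  stronglyConvex := by
    rintro _ ⟨A, hA, rfl⟩
    exact hD.stronglyConvex hA
  face_mem := by
    rintro _ ⟨A, hA, rfl⟩ τ hτ
    obtain ⟨B, hB, rfl⟩ := eq_coneOf_of_isFaceOf hτ
    exact ⟨B, hD.down_closed A hA B hB, rfl⟩
  inter_face := by
    rintro _ ⟨A, hA, rfl⟩ _ ⟨B, hB, rfl⟩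
    rw [hD.inf_coneOf hA hB]
    exact ⟨hD.isFaceOf hA Finset.inter_subset_left, hD.isFaceOf hB Finset.inter_subset_right⟩

theorem exists_le_of_mem_braidFan (hD : IsCoarse D) : ∀ ρ ∈ braidFan n, ∃ σ ∈ fanOf D, ρ ≤ σ := by
  rintro ρ ⟨w, hw⟩
  obtain ⟨A, hA, hle⟩ := hD.chamber_le w
  exact ⟨_, ⟨A, hA, rfl⟩, hw.le.trans hle⟩

theorem isCompleteFan (hD : IsCoarse D) : IsCompleteFan (fanOf D) :=
  Set.eq_univ_of_forall fun x =>
    let ⟨w, hw⟩ := exists_mem_weylChamber x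
    let ⟨A, hA, hle⟩ := hD.chamber_le w
    ⟨_, ⟨A, hA, rfl⟩, hle hw⟩

theorem isRefinedBy (hD : IsCoarse D) : IsRefinedBy (fanOf D) (braidFan n) :=
  ⟨hD.isCompleteFan.trans support_braidFan.symm, hD.exists_le_of_mem_braidFan⟩

theorem rayGens_coneOf (hD : IsCoarse D) {A : Finset (Finset (Fin n))} (hA : A ∈ D) :
    rayGens (coneOf A) = ind '' (A : Set (Finset (Fin n))) := by
  ext v
  constructor
  · rintro ⟨hv, hv0, hprim, hface⟩
    obtain ⟨B, hB, hvB⟩ := eq_coneOf_of_isFaceOf hface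
    obtain ⟨S, hS⟩ : B.Nonempty := by
      rw [Finset.nonempty_iff_ne_empty]
      rintro rfl
      have : v ∈ coneOf ∅ := hvB ▸ PointedCone.subset_hull rfl
      simp [coneOf, hv0] at this
    have hmem : ind S ∈ PointedCone.hull ℝ {v} := hvB ▸ ind_mem_coneOf hS
    obtain ⟨c, hc⟩ := Submodule.mem_span_singleton.1 hmem
    have hc : (c : ℝ) • v = ind S := hc
    have hproper := hD.proper A hA S (hB hS)
    have hc0 : 0 < (c : ℝ) := c.2.lt_of_ne' fun h => hproper.ind_ne_zero (by rw [← hc, h, zero_smul])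
    have hv' : (c : ℝ)⁻¹ • ind S = v := by rw [← hc, inv_smul_smul₀ hc0.ne']
    -- A factor below 1 contradicts primitivity of `v`, a factor above 1 primitivity of `ind S`.
    rcases lt_trichotomy (c : ℝ) 1 with h1 | h1 | h1
    · exact absurd (hc ▸ ind_mem_lattice S) (hprim c hc0 h1)
    · rw [h1, one_smul] at hc
      exact ⟨S, hB hS, hc.symm⟩
    · exact absurd (hv' ▸ hv) (hproper.smul_ind_notMem_lattice (inv_pos.2 hc0) (inv_lt_one_of_one_lt₀ h1))
  · rintro ⟨S, hS, rfl⟩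
    have hproper := hD.proper A hA S hS
    refine ⟨ind_mem_lattice S, hproper.ind_ne_zero,
      fun t h0 h1 => hproper.smul_ind_notMem_lattice h0 h1, ?_⟩
    have := hD.isFaceOf hA (Finset.singleton_subset_iff.2 hS)
    rwa [coneOf, Finset.coe_singleton, Set.image_singleton] at this

theorem mem_of_coarsens (hD : IsCoarse D) {A : Finset (Finset (Fin n))} (hA : A ∈ D) {x y : NR n}
    (hx : x ∈ coneOf A) (hyx : Coarsens y x) : y ∈ coneOf A :=
  hD.isFan.mem_of_coarsens hD.exists_le_of_mem_braidFan ⟨A, hA, rfl⟩ hx hyx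

/-- The sum of the generators is interior to `coneOf A`. A cone of the fan containing a chamber
through that point meets `coneOf A` in a face containing all its generators. -/
theorem exists_full (hD : IsCoarse D) {A : Finset (Finset (Fin n))} (hA : A ∈ D) :
    ∃ B ∈ D, A ⊆ B ∧ ∃ w, weylChamber w ≤ coneOf B := by
  have hx : ∑ S ∈ A, ind S ∈ coneOf A := Submodule.sum_mem _ fun S hS => ind_mem_coneOf hS
  obtain ⟨w, hw⟩ := exists_mem_weylChamber (∑ S ∈ A, ind S)
  obtain ⟨B, hB, hle⟩ := hD.chamber_le w
  refine ⟨B, hB, fun S hS => hD.mem_of_ind_mem hA hB hS ?_, w, hle⟩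
  have hface := (hD.isFan.inter_face _ ⟨A, hA, rfl⟩ _ ⟨B, hB, rfl⟩).1
  rw [← Finset.add_sum_erase _ _ hS] at hx hw
  exact (hface.mem_of_add_mem_left (ind_mem_coneOf hS)
    (Submodule.sum_mem _ fun T hT => ind_mem_coneOf (Finset.mem_of_mem_erase hT))
    ⟨hx, hle hw⟩).2

/-- Two distinct coordinates cannot agree on all of a full-dimensional cone. -/
theorem exists_separating {A : Finset (Finset (Fin n))} {w : Equiv.Perm (Fin n)}
    (hw : weylChamber w ≤ coneOf A) {a b : Fin n} (hab : a ≠ b) :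
    ∃ R ∈ A, ¬(a ∈ R ↔ b ∈ R) := by
  by_contra! h
  have hx : toNR (fun i => ((w i : ℕ) : ℝ)) ∈ weylChamber w :=
    (toNR_mem_preposetCone _ _).2 fun i j hij => by exact_mod_cast hij
  obtain ⟨f, hf, hfx⟩ := mem_coneOf.1 (hw hx)
  have h1 : coordDiff a b (comb f) = 0 := by
    rw [coordDiff_comb]
    refine Finset.sum_eq_zero fun R _ => ?_
    by_cases hR : f R = 0
    · simp [hR]
    · simp [coordDiff_ind, h R (hf.mem_of_ne_zero hR)]
  rw [hfx, coordDiff_toNR, sub_eq_zero] at h1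
  exact hab (w.injective (Fin.ext (by exact_mod_cast h1.symm)))

/-- In a full-dimensional cone, the coordinate dual to a ray is a coordinate difference. -/
theorem exists_dual (hD : IsCoarse D) {A : Finset (Finset (Fin n))} (hA : A ∈ D)
    {w : Equiv.Perm (Fin n)} (hw : weylChamber w ≤ coneOf A) {S : Finset (Fin n)} (hS : S ∈ A) :
    ∃ a b, a ∉ S ∧ b ∈ S ∧ ∀ R ∈ A, R ≠ S → (a ∈ R ↔ b ∈ R) := by
  classical
  by_contra! hcon
  have hsep : ∀ a b, a ≠ b → ∃ R ∈ A.erase S, ¬(a ∈ R ↔ b ∈ R) := by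
    intro a b hab
    by_contra! h
    obtain ⟨R, hR, hRab⟩ := exists_separating hw hab
    have h' : ∀ R ∈ A, R ≠ S → (a ∈ R ↔ b ∈ R) := fun R hR hRS =>
      h R (Finset.mem_erase.2 ⟨hRS, hR⟩)
    have hRS : R = S := by
      by_contra hne
      exact hRab (h' R hR hne)
    subst hRS
    by_cases ha : a ∈ R
    · have hb : b ∉ R := fun hb => hRab (by tauto)
      obtain ⟨Q, hQ, hQR, hQab⟩ := hcon b a hb ha
      have := h' Q hQ hQR
      tauto
    · have hb : b ∈ R := by tauto
      obtain ⟨Q, hQ, hQR, hQab⟩ := hcon a b ha hb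
      have := h' Q hQ hQR
      tauto
  -- The rays other than `S` already separate all coordinates. Weighting them by distinct powers of
  -- 2 gives a point whose coordinates `N i` are distinct integers.
  let e := Fintype.equivFin (Finset (Fin n))
  let N : Fin n → ℕ := fun i => ∑ k ∈ ((A.erase S).filter (i ∈ ·)).image (fun R => (e R : ℕ)), 2 ^ k
  have hN : Function.Injective N := by
    intro a b hab
    by_contra hne
    obtain ⟨R, hR, hRab⟩ := hsep a b hne
    have h1 := Finset.geomSum_injective le_rfl hab
    have hinj : Function.Injective fun R : Finset (Fin n) => (e R : ℕ) :=
      Fin.val_injective.comp e.injective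
    have h2 := Finset.image_injective hinj h1
    have h3 := Finset.ext_iff.1 h2 R
    simp only [Finset.mem_filter, hR, true_and] at h3
    exact hRab h3
  have hNf : ∀ i, (N i : ℝ) = ∑ R ∈ A.erase S, 2 ^ (e R : ℕ) * (if i ∈ R then 1 else 0) := by
    intro i
    simp only [N]
    rw [Finset.sum_image (fun x _ y _ h => e.injective (Fin.ext h)), Finset.sum_filter]
    push_cast
    refine Finset.sum_congr rfl fun R _ => ?_
    split_ifs <;> simp
  set f : Finset (Fin n) → ℝ := fun R => if R ∈ A.erase S then 2 ^ (e R : ℕ) else 0 with hf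
  have hfc : IsCoeff (A.erase S) f :=
    ⟨fun R => by simp only [hf]; split_ifs <;> positivity, fun R hR => if_neg hR⟩
  have hdiff : ∀ i j, coordDiff i j (comb f) = N j - N i := by
    intro i j
    rw [coordDiff_comb, hNf, hNf, ← Finset.sum_sub_distrib]
    simp only [hf, ite_mul, zero_mul, coordDiff_ind, ← mul_sub]
    rw [Finset.sum_ite_mem, Finset.univ_inter]
  have hA' : A.erase S ∈ D := hD.down_closed A hA _ (Finset.erase_subset _ _)
  -- Distinct integers differ by at least 1 and `ind S` changes a difference by at most 1, so no
  -- order is reversed. Closure under coarsening then puts `ind S + comb f` in the facet without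
  -- `S`, against uniqueness of coefficients.
  have hcoarse : Coarsens (ind S + comb f) (comb f) := by
    intro i j hij
    rw [map_add, coordDiff_ind, hdiff]
    rw [hdiff] at hij
    by_cases hne : i = j
    · subst hne; simp
    have h1 : N i < N j := lt_of_le_of_ne (by exact_mod_cast sub_nonneg.1 hij) (hN.ne hne)
    have h2 : (N i : ℝ) + 1 ≤ N j := by exact_mod_cast h1
    split_ifs <;> linarith
  obtain ⟨g, hg, hgx⟩ := mem_coneOf.1
    (hD.mem_of_coarsens hA' (mem_coneOf.2 ⟨f, hfc, rfl⟩) hcoarse)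
  have hadd := hD.coeff_unique A hA A hA _ g
    ((isCoeff_single hS zero_le_one).add (hfc.mono (Finset.erase_subset _ _)))
    (hg.mono (Finset.erase_subset _ _)) (by rw [comb_add, comb_single, one_smul, hgx])
  have h1 := congrFun hadd S
  rw [hg.eq_zero S (Finset.notMem_erase S A), Pi.add_apply, Pi.single_eq_same] at h1
  linarith [hfc.nonneg S]

theorem coordDiff_comb_of_dual {A : Finset (Finset (Fin n))} {S : Finset (Fin n)} {a b : Fin n}
    (ha : a ∉ S) (hb : b ∈ S) (hab : ∀ R ∈ A, R ≠ S → (a ∈ R ↔ b ∈ R))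
    {f : Finset (Fin n) → ℝ} (hf : ∀ R, R ∉ A → f R = 0) : coordDiff a b (comb f) = f S := by
  rw [coordDiff_comb, Finset.sum_eq_single S]
  · simp [coordDiff_ind, ha, hb]
  · intro R _ hR
    by_cases hRA : R ∈ A
    · simp [coordDiff_ind, hab R hRA hR]
    · simp [hf R hRA]
  · simp

/-- Dual coordinates are differences, hence integral on the lattice, so lattice points of a
full-dimensional cone are integral combinations of its rays. Each basis vector is a difference of
two up-set indicators lying in the chamber. -/
theorem isSmooth (hD : IsCoarse D) : IsSmooth (fanOf D) := by
  rintro _ ⟨A, hA, rfl⟩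
  obtain ⟨B, hB, hAB, w, hw⟩ := hD.exists_full hA
  rw [IsSmoothCone, hD.rayGens_coneOf hA]
  refine ⟨ind '' (B : Set (Finset (Fin n))), Set.image_mono hAB, ?_, ?_⟩
  · refine LinearIndepOn.id_image (linearIndepOn_finset_iff.2 fun g hg S hS => ?_)
    obtain ⟨a, b, ha, hb, hab⟩ := hD.exists_dual hB hw hS
    have h1 := coordDiff_comb_of_dual (A := B) ha hb hab
      (f := fun R => if R ∈ B then (g R : ℝ) else 0) fun R hR => if_neg hR
    have h2 : comb (fun R => if R ∈ B then (g R : ℝ) else 0) = 0 := by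
      simp only [comb, ite_smul, zero_smul]
      rw [Finset.sum_ite_mem, Finset.univ_inter, ← hg]
      exact Finset.sum_congr rfl fun R _ => Int.cast_smul_eq_zsmul ℝ _ _
    rw [h2, map_zero, if_pos hS] at h1
    exact_mod_cast h1.symm
  · refine le_antisymm (Submodule.span_le.2 ?_) ?_
    · rintro _ ⟨S, -, rfl⟩
      exact ind_mem_lattice S
    have hmem : ∀ x ∈ lattice n, x ∈ coneOf B →
        x ∈ Submodule.span ℤ (ind '' (B : Set (Finset (Fin n)))) := by
      intro x hx hxB
      obtain ⟨f, hf, rfl⟩ := mem_coneOf.1 hxB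
      refine Submodule.sum_mem _ fun S _ => ?_
      by_cases hS : S ∈ B
      · obtain ⟨a, b, ha, hb, hab⟩ := hD.exists_dual hB hw hS
        obtain ⟨m, hm⟩ := exists_int_coordDiff hx a b
        rw [coordDiff_comb_of_dual ha hb hab hf.eq_zero] at hm
        rw [hm, Int.cast_smul_eq_zsmul]
        exact Submodule.smul_mem _ _ (Submodule.subset_span ⟨S, hS, rfl⟩)
      · simp [hf.eq_zero S hS]
    refine Submodule.span_le.2 ?_
    rintro _ ⟨i, rfl⟩
    have hi : toNR (Pi.single i (1 : ℝ)) =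
        ind (Finset.univ.filter fun j => w i ≤ w j) -
          ind (Finset.univ.filter fun j => w i < w j) := by
      refine eq_of_coordDiff_eq fun p q => ?_
      have key : ∀ k, (Pi.single i (1 : ℝ) : Fin n → ℝ) k =
          (if w i ≤ w k then 1 else 0) - (if w i < w k then 1 else 0) := by
        intro k
        rw [Pi.single_apply]
        rcases lt_trichotomy (w i) (w k) with h | h | h
        · have : k ≠ i := by rintro rfl; exact lt_irrefl _ h
          simp [h, h.le, this]
        · simp [w.injective h]
        · have : k ≠ i := by rintro rfl; exact lt_irrefl _ h
          simp [h.not_ge, h.not_gt, this]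
      simp only [map_sub, coordDiff_toNR, coordDiff_ind, key, Finset.mem_filter, Finset.mem_univ,
        true_and]
      ring
    change toNR (Pi.single i (1 : ℝ)) ∈ _
    rw [hi]
    refine sub_mem (hmem _ (ind_mem_lattice _) (hw fun p q hpq => ?_))
      (hmem _ (ind_mem_lattice _) (hw fun p q hpq => ?_)) <;>
    · rw [coordDiff_ind, sub_nonneg]
      simp only [Finset.mem_filter, Finset.mem_univ, true_and]
      split_ifs <;> first | order | simp

/-- Two rays of a common cone are nested, disjoint or cover `[n]`. -/
theorem cross_free (hD : IsCoarse D) {A : Finset (Finset (Fin n))} (hA : A ∈ D)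
    {S T : Finset (Fin n)} (hS : S ∈ A) (hT : T ∈ A) :
    S ⊆ T ∨ T ⊆ S ∨ (∀ i, i ∈ S → i ∉ T) ∨ ∀ i, i ∈ S ∨ i ∈ T := by
  classical
  by_contra! ⟨h1, h2, ⟨r, hrS, hrT⟩, ⟨s, hsS, hsT⟩⟩
  obtain ⟨p, hpS, hpT⟩ := Finset.not_subset.1 h1
  obtain ⟨q, hqT, hqS⟩ := Finset.not_subset.1 h2
  have hST : S ≠ T := by rintro rfl; exact h1 subset_rfl
  have hfi : comb (Pi.single S 1 + Pi.single T 1) = ind S + ind T := by simp [comb_add]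
  have hx : ind S + ind T ∈ coneOf A := add_mem (ind_mem_coneOf hS) (ind_mem_coneOf hT)
  -- If `S` and `T` cross, `ind (S ∩ T)` and `ind (S ∪ T)` both lie in the cone, and their sum is
  -- `ind S + ind T`. Uniqueness makes `ind (S ∩ T)` a combination of `ind S` and `ind T`, which
  -- comparison at `p`, `q`, `r` with `s` excludes.
  have hc1 : Coarsens (ind (S ∩ T)) (ind S + ind T) := by
    intro i j h
    rw [map_add, coordDiff_ind, coordDiff_ind] at h
    rw [coordDiff_ind]
    simp only [Finset.mem_inter]
    by_cases h1 : i ∈ S <;> by_cases h2 : i ∈ T <;> by_cases h3 : j ∈ S <;> by_cases h4 : j ∈ T <;>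
      simp [h1, h2, h3, h4] at h ⊢ <;> linarith
  have hc2 : Coarsens (ind (S ∪ T)) (ind S + ind T) := by
    intro i j h
    rw [map_add, coordDiff_ind, coordDiff_ind] at h
    rw [coordDiff_ind]
    simp only [Finset.mem_union]
    by_cases h1 : i ∈ S <;> by_cases h2 : i ∈ T <;> by_cases h3 : j ∈ S <;> by_cases h4 : j ∈ T <;>
      simp [h1, h2, h3, h4] at h ⊢ <;> linarith
  obtain ⟨f, hf, hfx⟩ := mem_coneOf.1 (hD.mem_of_coarsens hA hx hc1)
  obtain ⟨g, hg, hgx⟩ := mem_coneOf.1 (hD.mem_of_coarsens hA hx hc2)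
  have hfg := hD.coeff_unique A hA A hA _ _ (hf.add hg)
    ((isCoeff_single hS zero_le_one).add (isCoeff_single hT zero_le_one)) (by
      rw [comb_add, hfx, hgx, hfi]
      refine eq_of_coordDiff_eq fun i j => ?_
      simp only [map_add, coordDiff_ind, Finset.mem_inter, Finset.mem_union]
      by_cases h1 : i ∈ S <;> by_cases h2 : i ∈ T <;> by_cases h3 : j ∈ S <;>
        by_cases h4 : j ∈ T <;> simp [h1, h2, h3, h4])
  have hzero : ∀ R, R ≠ S → R ≠ T → f R = 0 := by
    intro R h1 h2
    have := congrFun hfg R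
    simp only [Pi.add_apply, Pi.single_eq_of_ne h1, Pi.single_eq_of_ne h2] at this
    linarith [hf.nonneg R, hg.nonneg R]
  have hcomb : comb f = f S • ind S + f T • ind T := by
    rw [comb, ← Finset.sum_pair (f := fun R => f R • ind R) hST]
    refine (Finset.sum_subset (Finset.subset_univ _) fun R _ hR => ?_).symm
    simp only [Finset.mem_insert, Finset.mem_singleton, not_or] at hR
    simp [hzero R hR.1 hR.2]
  have e1 := congrArg (coordDiff s p) (hfx.symm.trans hcomb)
  have e2 := congrArg (coordDiff s q) (hfx.symm.trans hcomb)
  have e3 := congrArg (coordDiff s r) (hfx.symm.trans hcomb)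
  simp [coordDiff_ind, *] at e1 e2 e3
  rw [← e1, ← e2] at e3
  norm_num at e3

end IsCoarse

/-! ### Coarse fans come from simplicial complexes on subsets -/

/-- The coordinate functionals of a `ℤ`-basis of the lattice extend to `N_ℝ`. -/
theorem exists_dual_of_lattice_basis {S : Set (NR n)} (hS : LinearIndepOn ℤ id S)
    (hspan : Submodule.span ℤ S = lattice n) {v : NR n} (hv : v ∈ S) :
    ∃ φ : NR n →ₗ[ℝ] ℝ, φ v = 1 ∧ ∀ u ∈ S, u ≠ v → φ u = 0 := by
  have hS' : LinearIndependent ℤ (Subtype.val : S → NR n) := hS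
  have hr : Submodule.span ℤ (Set.range (Subtype.val : S → NR n)) = lattice n := by
    rw [Subtype.range_coe, hspan]
  let c : lattice n →ₗ[ℤ] ℤ :=
    (Finsupp.lapply ⟨v, hv⟩ ∘ₗ hS'.repr) ∘ₗ (LinearEquiv.ofEq _ _ hr.symm).toLinearMap
  have he : ∀ i, toNR (Pi.single i (1 : ℝ)) ∈ lattice n := fun i => Submodule.subset_span ⟨i, rfl⟩
  let m : Fin n → ℤ := fun i => c ⟨_, he i⟩
  -- The basis vectors sum to zero in `N`, so the weights `m i` define a functional on the quotient.
  have hm : ∑ i, m i = 0 := by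
    simp only [m]
    rw [← map_sum]
    convert c.map_zero
    refine Subtype.ext ?_
    rw [AddSubmonoidClass.coe_finsetSum]
    refine eq_of_coordDiff_eq fun i j => ?_
    simp [map_sum, coordDiff_toNR, Pi.single_apply]
  let ψ : (Fin n → ℝ) →ₗ[ℝ] ℝ := ∑ i, (m i : ℝ) • LinearMap.proj i
  have hψ : Submodule.span ℝ {(1 : Fin n → ℝ)} ≤ LinearMap.ker ψ := by
    rw [Submodule.span_le, Set.singleton_subset_iff]
    simp only [ψ, SetLike.mem_coe, LinearMap.mem_ker, LinearMap.sum_apply, LinearMap.smul_apply,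
      LinearMap.proj_apply, Pi.one_apply, smul_eq_mul, mul_one]
    exact_mod_cast hm
  let φ : NR n →ₗ[ℝ] ℝ := Submodule.liftQ _ ψ hψ
  have hφ : ∀ x (hx : x ∈ lattice n), φ x = c ⟨x, hx⟩ := by
    intro x hx
    have hx' := hx
    unfold lattice at hx'
    induction hx' using Submodule.span_induction with
    | mem x h =>
      obtain ⟨i, rfl⟩ := h
      change ψ (Pi.single i 1) = _
      simp [ψ, m, Pi.single_apply]
    | zero => rw [map_zero]; exact_mod_cast c.map_zero.symm
    | add x y hx1 hy1 hx2 hy2 =>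
      rw [map_add, hx2 hx1, hy2 hy1, ← Int.cast_add, ← map_add]
      rfl
    | smul k x hx1 hx2 =>
      rw [map_zsmul, hx2 hx1, ← Int.cast_smul_eq_zsmul ℝ, smul_eq_mul, ← Int.cast_mul,
        ← smul_eq_mul, ← map_smul]
      rfl
  have hc : ∀ u (hu : u ∈ S), φ u = Finsupp.single (⟨u, hu⟩ : S) (1 : ℤ) ⟨v, hv⟩ := by
    intro u hu
    have hul : u ∈ lattice n := hspan ▸ Submodule.subset_span hu
    rw [hφ u hul]
    simp only [c, LinearMap.comp_apply, Finsupp.lapply_apply]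
    congr 2
    exact hS'.repr_eq_single ⟨u, hu⟩ _ rfl
  refine ⟨φ, by simp [hc v hv], fun u hu huv => ?_⟩
  rw [hc u hu, Finsupp.single_eq_of_ne]
  · simp
  · intro h
    exact huv (congrArg Subtype.val h).symm

open Classical in
/-- The subsets of `[n]` whose indicators are the minimal ray generators of `σ`. -/
noncomputable def raySets (σ : Cone n) : Finset (Finset (Fin n)) :=
  Finset.univ.filter fun S => IsProper S ∧ ind S ∈ rayGens σ

theorem mem_raySets {σ : Cone n} {S : Finset (Fin n)} :
    S ∈ raySets σ ↔ IsProper S ∧ (PointedCone.hull ℝ {ind S}).IsFaceOf σ := by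
  classical
  rw [raySets, Finset.mem_filter]
  exact ⟨fun h => ⟨h.2.1, h.2.2.2.2.2⟩, fun h => ⟨Finset.mem_univ S, h.1, ind_mem_lattice S,
    h.1.ind_ne_zero, fun t h0 h1 => h.1.smul_ind_notMem_lattice h0 h1, h.2⟩⟩

theorem ind_mem_of_mem_raySets {σ : Cone n} {S : Finset (Fin n)} (h : S ∈ raySets σ) :
    ind S ∈ σ :=
  (mem_raySets.1 h).2.le (PointedCone.subset_hull rfl)

/-- The one place where smoothness of the given fan enters: functionals dual to a lattice basis
containing the rays read off the coefficients. -/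
theorem coeff_unique_of_isSmoothCone {σ : Cone n} (hσ : IsSmoothCone σ)
    {f g : Finset (Fin n) → ℝ} (hf : IsCoeff (raySets σ) f) (hg : IsCoeff (raySets σ) g)
    (h : comb f = comb g) : f = g := by
  obtain ⟨B, hB, hind, hspan⟩ := hσ
  have hmem : ∀ R ∈ raySets σ, ind R ∈ B := fun R hR => by
    simp only [raySets, Finset.mem_filter] at hR
    exact hB hR.2.2
  funext S
  by_cases hS : S ∈ raySets σ
  · obtain ⟨φ, h1, h0⟩ := exists_dual_of_lattice_basis hind hspan (hmem S hS)
    have key : ∀ f, IsCoeff (raySets σ) f → φ (comb f) = f S := by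
      intro f hf
      rw [comb, map_sum, Finset.sum_eq_single S]
      · simp [h1]
      · intro R _ hRS
        by_cases hR : R ∈ raySets σ
        · rw [map_smul, h0 _ (hmem R hR), smul_zero]
          intro he
          exact hRS ((mem_raySets.1 hR).1.ind_injective (mem_raySets.1 hS).1 one_pos
            (by rw [he, one_smul]))
        · simp [hf.eq_zero R hR]
      · simp
    rw [← key f hf, ← key g hg, h]
  · rw [hf.eq_zero S hS, hg.eq_zero S hS]

/-- In an irredundant set of generators of a strongly convex cone, each one spans a ray. -/
theorem isFaceOf_of_irredundant {G : Finset (Finset (Fin n))}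
    (hG : IsStronglyConvex (coneOf G)) {S : Finset (Fin n)} (hS : S ∈ G)
    (hirr : ind S ∉ coneOf (G.erase S)) :
    (PointedCone.hull ℝ {ind S}).IsFaceOf (coneOf G) := by
  refine .of_mem_of_add_mem_left (Submodule.span_le.2 (Set.singleton_subset_iff.2
    (ind_mem_coneOf hS))) fun {x y} hx hy hxy => ?_
  obtain ⟨f, hf, rfl⟩ := mem_coneOf.1 hx
  obtain ⟨g, hg, rfl⟩ := mem_coneOf.1 hy
  obtain ⟨c, hc⟩ := Submodule.mem_span_singleton.1 hxy
  have hc : (c : ℝ) • ind S = comb f + comb g := hc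
  have hsplit : ∀ f, IsCoeff G f → IsCoeff (G.erase S) (Function.update f S 0) ∧
      comb f = comb (Function.update f S 0) + f S • ind S := by
    intro f hf
    refine ⟨⟨fun R => ?_, fun R hR => ?_⟩, ?_⟩
    · rw [Function.update_apply]; split_ifs; exacts [le_rfl, hf.nonneg R]
    · rw [Function.update_apply]; split_ifs with h
      · rfl
      · exact hf.eq_zero R fun hRG => hR (Finset.mem_erase.2 ⟨h, hRG⟩)
    · rw [← comb_single, ← comb_add]
      congr 1
      funext R
      by_cases h : R = S
      · subst h; simp
      · simp [h]
  obtain ⟨hf', hfx⟩ := hsplit f hf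
  obtain ⟨hg', hgx⟩ := hsplit g hg
  set f' := Function.update f S 0
  set g' := Function.update g S 0
  have hd : comb (f' + g') = (c - f S - g S) • ind S := by
    rw [comb_add, sub_smul, sub_smul, hc, hfx, hgx]; abel
  -- A positive multiple would make `S` redundant. Otherwise `-comb f'` lies in the cone, and strong
  -- convexity gives `comb f' = 0`.
  rcases lt_or_ge 0 (c - f S - g S) with h0 | h0
  · refine absurd (mem_coneOf.2 ⟨_, (hf'.add hg').smul (inv_nonneg.2 h0.le), ?_⟩) hirr
    rw [comb_smul, hd, inv_smul_smul₀ h0.ne']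
  · have hsub := Finset.erase_subset S G
    have hneg : -comb f' = comb (g' + Pi.single S (-(c - f S - g S))) := by
      rw [comb_add, comb_single, neg_smul, ← hd, comb_add]; abel
    have hf0 := hG (comb f') (mem_coneOf.2 ⟨_, hf'.mono hsub, rfl⟩) (hneg ▸ mem_coneOf.2
      ⟨_, (hg'.mono hsub).add (isCoeff_single hS (neg_nonneg.2 h0)), rfl⟩)
    rw [hfx, hf0, zero_add]
    exact PointedCone.smul_mem _ (hf.nonneg S) (PointedCone.subset_hull rfl)

/-- All proper indicators in `σ` generate it by closure under coarsening; a minimal generating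
subfamily is irredundant, so it consists of rays. -/
theorem eq_coneOf_raySets {F : Set (Cone n)} (hF : IsFan F)
    (href : ∀ ρ ∈ braidFan n, ∃ σ ∈ F, ρ ≤ σ) {σ : Cone n} (hσ : σ ∈ F) :
    σ = coneOf (raySets σ) := by
  classical
  obtain ⟨G, -, ⟨hGp, hG⟩, hmin⟩ := exists_minimal_le_of_wellFoundedLT
    (fun G : Finset (Finset (Fin n)) => (∀ S ∈ G, IsProper S) ∧ coneOf G = σ)
    (Finset.univ.filter fun S => IsProper S ∧ ind S ∈ σ) (by
      refine ⟨fun S hS => (Finset.mem_filter.1 hS).2.1, le_antisymm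
        (coneOf_le.2 fun S hS => (Finset.mem_filter.1 hS).2.2) fun x hx => ?_⟩
      obtain ⟨f, hf0, hf, rfl⟩ := exists_comb_coarsens x
      exact comb_mem hf0 fun S hS => ind_mem_coneOf (Finset.mem_filter.2
        ⟨Finset.mem_univ _, (hf S hS).1, hF.mem_of_coarsens href hσ hx (hf S hS).2⟩))
  refine le_antisymm ?_ (coneOf_le.2 fun S hS => ind_mem_of_mem_raySets hS)
  conv_lhs => rw [← hG]
  refine coneOf_mono fun S hS => mem_raySets.2 ⟨hGp S hS, ?_⟩
  rw [← hG]
  refine isFaceOf_of_irredundant (hG ▸ hF.stronglyConvex σ hσ) hS fun hmem => ?_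
  have hle : coneOf (G.erase S) = σ := by
    rw [← hG]
    refine le_antisymm (coneOf_mono (Finset.erase_subset _ _)) (coneOf_le.2 fun R hR => ?_)
    by_cases h : R = S
    · exact h ▸ hmem
    · exact ind_mem_coneOf (Finset.mem_erase.2 ⟨h, hR⟩)
  exact Finset.notMem_erase S G (hmin ⟨fun R hR => hGp R (Finset.mem_of_mem_erase hR), hle⟩
    (Finset.erase_subset _ _) hS)

/-- A smooth fan refined by the braid arrangement fan is given by a simplicial complex on the
proper nonempty subsets of `[n]`. -/
theorem exists_isCoarse {F : Set (Cone n)} (hF : IsFan F) (hsmooth : IsSmooth F)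
    (href : ∀ ρ ∈ braidFan n, ∃ σ ∈ F, ρ ≤ σ) : ∃ D, IsCoarse D ∧ fanOf D = F := by
  have hD : IsCoarse {A : Finset (Finset (Fin n)) | ∃ σ ∈ F, A ⊆ raySets σ} := by
    refine ⟨?_, ?_, ?_, ?_⟩
    · rintro A ⟨σ, hσ, hA⟩ B hB
      exact ⟨σ, hσ, hB.trans hA⟩
    · rintro A ⟨σ, hσ, hA⟩ S hS
      exact (mem_raySets.1 (hA hS)).1
    · rintro A ⟨σ, hσ, hA⟩ B ⟨τ, hτ, hB⟩ f g hf hg hfg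
      have hf := hf.mono hA
      have hg := hg.mono hB
      have hmem : comb f ∈ σ ⊓ τ :=
        ⟨comb_mem hf.nonneg fun S hS => ind_mem_of_mem_raySets (hf.mem_of_ne_zero hS),
          hfg ▸ comb_mem hg.nonneg fun S hS => ind_mem_of_mem_raySets (hg.mem_of_ne_zero hS)⟩
      obtain ⟨h1, h2⟩ := hF.inter_face σ hσ τ hτ
      -- A ray of `σ` used by a point of `σ ⊓ τ` lies in this common face, hence is a ray of `τ`.
      -- Both expansions are then compared inside `τ`.
      refine coeff_unique_of_isSmoothCone (hsmooth τ hτ) ⟨hf.nonneg, fun S hS => ?_⟩ hg hfg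
      by_contra hne
      have hSσ := mem_raySets.1 (hf.mem_of_ne_zero hne)
      refine hS (mem_raySets.2 ⟨hSσ.1, ((hSσ.2.isFaceOf_iff_le h1).2 ?_).trans h2⟩)
      refine Submodule.span_le.2 (Set.singleton_subset_iff.2 (h1.mem_of_sum_smul_mem
        (f := fun S : {S // S ∈ raySets σ} => ind S.1) (c := fun S => f S.1)
        (fun S => ind_mem_of_mem_raySets S.2) (fun S => hf.nonneg _) ?_
        ⟨S, hf.mem_of_ne_zero hne⟩ ((hf.nonneg S).lt_of_ne' hne)))
      convert hmem using 1
      rw [comb, Finset.sum_coe_sort (raySets σ) (fun S => f S • ind S)]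
      exact Finset.sum_subset (Finset.subset_univ _) fun R _ hR => by simp [hf.eq_zero R hR]
    · intro w
      obtain ⟨σ, hσ, hle⟩ := href _ (weylChamber_mem_braidFan w)
      exact ⟨raySets σ, ⟨σ, hσ, subset_rfl⟩, hle.trans (eq_coneOf_raySets hF href hσ).le⟩
  refine ⟨_, hD, Set.ext fun σ => ⟨?_, fun hσ => ⟨raySets σ, ⟨σ, hσ, subset_rfl⟩,
    (eq_coneOf_raySets hF href hσ).symm⟩⟩⟩
  rintro ⟨A, ⟨τ, hτ, hA⟩, rfl⟩
  have := hD.isFaceOf ⟨τ, hτ, subset_rfl⟩ hA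
  rw [← eq_coneOf_raySets hF href hτ] at this
  exact hF.face_mem τ hτ _ this

/-! ### Star subdivisions at two-dimensional cones -/

/-- The weight of `T` is moved to `V`, which leaves `f S - f T ≥ 0` at `S`. -/
theorem comb_mem_coneOf_insert_erase {A : Finset (Finset (Fin n))} {S T V : Finset (Fin n)}
    (hS : S ∈ A) (hST : S ≠ T) (hTV : T ≠ V) (hind : ind V = ind S + ind T)
    {f : Finset (Fin n) → ℝ} (hf : IsCoeff A f) (hle : f T ≤ f S) :
    comb f ∈ coneOf (insert V (A.erase T)) := by
  have h : comb f = comb (Function.update f T 0 + Pi.single S (-f T)) + f T • ind V := by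
    have h1 : f = Function.update f T 0 + Pi.single T (f T) := by
      funext R
      by_cases h : R = T
      · subst h; simp
      · simp [h]
    conv_lhs => rw [h1]
    rw [comb_add, comb_add, comb_single, comb_single, hind, smul_add, neg_smul]
    abel
  rw [h]
  refine add_mem (comb_mem (fun R => ?_) fun R hR => ind_mem_coneOf ?_)
    (PointedCone.smul_mem _ (hf.nonneg T) (ind_mem_coneOf (Finset.mem_insert_self _ _)))
  · by_cases h1 : R = S
    · subst h1
      simpa [hST] using hle
    · rw [Pi.add_apply, Pi.single_eq_of_ne h1, add_zero, Function.update_apply]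
      split_ifs
      exacts [le_rfl, hf.nonneg R]
  · refine Finset.mem_insert_of_mem (Finset.mem_erase.2 ⟨?_, ?_⟩)
    · rintro rfl
      simp [hST.symm] at hR
    · by_cases h1 : R = S
      · exact h1 ▸ hS
      · refine hf.mem_of_ne_zero fun h2 => hR ?_
        rw [Pi.add_apply, Pi.single_eq_of_ne h1, add_zero, Function.update_apply, h2, ite_self]

/-- The simplicial complex of the star subdivision at the edge `{S, T}` with new vertex `V`. -/
def starComplex (D : Set (Finset (Finset (Fin n)))) (S T V : Finset (Fin n)) :
    Set (Finset (Finset (Fin n))) :=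
  {A | ¬(S ∈ A ∧ T ∈ A) ∧ (A ∈ D ∨ ∃ C ∈ D, S ∈ C ∧ T ∈ C ∧ A ⊆ insert V C)}

/-- Moves the weight at `V` to `S` and `T`. -/
def spread (S T V : Finset (Fin n)) (f : Finset (Fin n) → ℝ) : Finset (Fin n) → ℝ :=
  fun R => if R = V then 0 else if R = S ∨ R = T then f R + f V else f R

theorem comb_spread {S T V : Finset (Fin n)} (hST : S ≠ T) (hSV : S ≠ V) (hTV : T ≠ V)
    (hind : ind V = ind S + ind T) (f : Finset (Fin n) → ℝ) : comb (spread S T V f) = comb f := by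
  have : spread S T V f =
      f + (Pi.single S (f V) + (Pi.single T (f V) + Pi.single V (-f V))) := by
    funext R
    simp only [spread, Pi.add_apply]
    by_cases hV : R = V
    · subst hV; simp [hSV.symm, hTV.symm]
    by_cases hS : R = S
    · subst hS; simp [hST, hSV]
    by_cases hT : R = T
    · subst hT; simp [hS, hV]
    simp [hV, hS, hT]
  rw [this, comb_add, comb_add, comb_add, comb_single, comb_single, comb_single, hind, neg_smul,
    smul_add]
  abel

namespace IsCoarse

variable {D : Set (Finset (Finset (Fin n)))}

/-- The expansion of `ind V` with nonzero weight at both `S` and `T` would compete with `V` alone.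
-/
theorem notMem_of_ind_eq_add (hD : IsCoarse D) {A₀ : Finset (Finset (Fin n))} (hA₀ : A₀ ∈ D)
    {S T V : Finset (Fin n)} (hS : S ∈ A₀) (hT : T ∈ A₀) (hST : S ≠ T)
    (hind : ind V = ind S + ind T) {A : Finset (Finset (Fin n))} (hA : A ∈ D) : V ∉ A := by
  intro hV
  have h := hD.coeff_unique A₀ hA₀ A hA _ _
    ((isCoeff_single hS zero_le_one).add (isCoeff_single hT zero_le_one))
    (isCoeff_single hV zero_le_one) (by simp [comb_add, hind])
  have h1 := congrFun h S
  have h2 := congrFun h T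
  simp only [Pi.add_apply, Pi.single_apply, hST, hST.symm, if_true, if_false] at h1 h2
  by_cases h3 : S = V
  · have h4 : T ≠ V := fun h => hST (h3.trans h.symm)
    simp [h4] at h2
  · simp [h3] at h1

/-- The complex of a star subdivision has the same properties, provided that each chamber in a
subdivided cone stays inside one of the parts. -/
theorem starComplex (hD : IsCoarse D) {A₀ : Finset (Finset (Fin n))} (hA₀ : A₀ ∈ D)
    {S T V : Finset (Fin n)} (hS : S ∈ A₀) (hT : T ∈ A₀) (hST : S ≠ T) (hV : IsProper V)
    (hind : ind V = ind S + ind T)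
    (hchamber : ∀ A ∈ D, S ∈ A → T ∈ A → ∀ w, weylChamber w ≤ coneOf A →
      weylChamber w ≤ coneOf (insert V (A.erase S)) ∨
        weylChamber w ≤ coneOf (insert V (A.erase T))) :
    IsCoarse (starComplex D S T V) := by
  have hVD := fun {A} => hD.notMem_of_ind_eq_add hA₀ hS hT hST hind (A := A)
  have hSV : S ≠ V := by rintro rfl; exact hVD hA₀ hS
  have hTV : T ≠ V := by rintro rfl; exact hVD hA₀ hT
  refine ⟨?_, ?_, ?_, ?_⟩
  · rintro A ⟨h1, h2⟩ B hB
    refine ⟨fun h => h1 ⟨hB h.1, hB h.2⟩, h2.imp (fun h => hD.down_closed A h B hB) ?_⟩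
    rintro ⟨C, hC, h3, h4, h5⟩
    exact ⟨C, hC, h3, h4, hB.trans h5⟩
  · rintro A ⟨-, hA | ⟨C, hC, -, -, hAC⟩⟩ R hR
    · exact hD.proper A hA R hR
    · rcases Finset.mem_insert.1 (hAC hR) with rfl | h
      exacts [hV, hD.proper C hC R h]
  · have hspread : ∀ A ∈ BraidFan.starComplex D S T V, ∀ f, IsCoeff A f →
        (∃ C ∈ D, IsCoeff C (spread S T V f)) ∧
          f V = min (spread S T V f S) (spread S T V f T) := by
      rintro A ⟨hA, hA'⟩ f hf
      constructor
      · rcases hA' with h | ⟨C, hC, hSC, hTC, hAC⟩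
        · refine ⟨A, h, ?_⟩
          have h0 : f V = 0 := hf.eq_zero V (hVD h)
          convert hf using 1
          funext R
          simp only [spread, h0, add_zero, ite_self]
          split_ifs with h
          exacts [h ▸ h0.symm, rfl]
        · refine ⟨C, hC, fun R => ?_, fun R hR => ?_⟩
          · have h1 := hf.nonneg R
            have h2 := hf.nonneg V
            simp only [spread]
            split_ifs <;> positivity
          · simp only [spread]
            split_ifs with h1 h2
            · rfl
            · rcases h2 with rfl | rfl <;> contradiction
            · exact hf.eq_zero R fun h => (Finset.mem_insert.1 (hAC h)).elim h1 hR
      · have h1 := hf.nonneg S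
        have h2 := hf.nonneg T
        simp only [spread, hSV, hTV, if_false, true_or, or_true, if_true]
        by_cases hSA : S ∈ A
        · have hTA : T ∉ A := fun h => hA ⟨hSA, h⟩
          rw [hf.eq_zero T hTA, min_eq_right] <;> linarith
        · rw [hf.eq_zero S hSA, min_eq_left] <;> linarith
    intro A hA B hB f g hf hg hfg
    obtain ⟨⟨A', hA', hf'⟩, hfV⟩ := hspread A hA f hf
    obtain ⟨⟨B', hB', hg'⟩, hgV⟩ := hspread B hB g hg
    have heq := hD.coeff_unique A' hA' B' hB' _ _ hf' hg'
      (by rw [comb_spread hST hSV hTV hind, comb_spread hST hSV hTV hind, hfg])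
    have hV : f V = g V := by rw [hfV, hgV, heq]
    funext R
    have h := congrFun heq R
    simp only [spread] at h
    split_ifs at h with h1 h2
    · rw [h1, hV]
    · linarith
    · exact h
  · intro w
    obtain ⟨A, hA, hle⟩ := hD.chamber_le w
    by_cases h : S ∈ A ∧ T ∈ A
    · rcases hchamber A hA h.1 h.2 w hle with h' | h'
      · refine ⟨_, ⟨?_, Or.inr ⟨A, hA, h.1, h.2, ?_⟩⟩, h'⟩
        · simp [hSV]
        · exact Finset.insert_subset_insert _ (Finset.erase_subset _ _)
      · refine ⟨_, ⟨?_, Or.inr ⟨A, hA, h.1, h.2, ?_⟩⟩, h'⟩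
        · simp [hTV]
        · exact Finset.insert_subset_insert _ (Finset.erase_subset _ _)
    · exact ⟨A, ⟨h, Or.inl hA⟩, hle⟩

theorem fanOf_starComplex (hD : IsCoarse D) {A₀ : Finset (Finset (Fin n))} (hA₀ : A₀ ∈ D)
    {S T V : Finset (Fin n)} (hS : S ∈ A₀) (hT : T ∈ A₀) (hST : S ≠ T)
    (hind : ind V = ind S + ind T) (hD' : IsCoarse (BraidFan.starComplex D S T V)) :
    fanOf (BraidFan.starComplex D S T V) = starSubdivision (fanOf D) (coneOf {S, T}) := by
  classical
  have hpair : {S, T} ∈ D := hD.down_closed A₀ hA₀ _ (by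
    simp [Finset.insert_subset_iff, hS, hT])
  have hrays : rayGens (coneOf {S, T}) = {ind S, ind T} := by
    rw [hD.rayGens_coneOf hpair]
    simp [Set.image_pair]
  have hne : ind S ≠ ind T := fun h => hST (hD.ind_injOn hA₀ hA₀ hS hT one_pos (by
    rw [h, one_smul]))
  have hsum : rayGenSum (coneOf {S, T}) = ind V := by
    rw [rayGenSum, hrays, finsum_mem_pair hne, hind]
  have hle : ∀ A ∈ D, coneOf {S, T} ≤ coneOf A ↔ S ∈ A ∧ T ∈ A := fun A hA => by
    rw [hD.coneOf_le_coneOf hpair hA, Finset.insert_subset_iff, Finset.singleton_subset_iff]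
  have hmem : ∀ A, (∀ R ∈ A, IsProper R) → ∀ R, IsProper R →
      (ind R ∈ ind '' (A : Set (Finset (Fin n))) ↔ R ∈ A) := by
    refine fun A hA R hR => ⟨?_, fun h => ⟨R, h, rfl⟩⟩
    rintro ⟨Q, hQ, h⟩
    rwa [← (hA Q hQ).ind_injective hR one_pos (by rw [h, one_smul])]
  have hSp := hD.proper A₀ hA₀ S hS
  have hTp := hD.proper A₀ hA₀ T hT
  ext ρ
  constructor
  · rintro ⟨A, hA, rfl⟩
    rcases hA.2 with h | ⟨C, hC, hSC, hTC, hAC⟩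
    · exact Or.inl ⟨⟨A, h, rfl⟩, fun h' => hA.1 ((hle A h).1 h')⟩
    · refine Or.inr (Set.mem_biUnion (x := coneOf C) ⟨⟨C, hC, rfl⟩, (hle C hC).2 ⟨hSC, hTC⟩⟩
        ⟨ind '' (A : Set (Finset (Fin n))), ?_, ?_, rfl⟩)
      · rw [hsum, hD.rayGens_coneOf hC, ← Set.image_singleton, ← Set.image_union]
        refine Set.image_mono fun R hR => ?_
        have := hAC hR
        simpa [or_comm] using this
      · rw [hrays, Set.insert_subset_iff, Set.singleton_subset_iff,
          hmem A (hD'.proper A hA) S hSp, hmem A (hD'.proper A hA) T hTp]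
        exact hA.1
  · rintro (⟨⟨A, hA, rfl⟩, h⟩ | h)
    · exact ⟨A, ⟨fun h' => h ((hle A hA).2 h'), Or.inl hA⟩, rfl⟩
    · obtain ⟨_, ⟨⟨C, hC, rfl⟩, hτ⟩, A', hA', hnot, rfl⟩ := by
        simpa only [Set.mem_iUnion, exists_prop] using h
      obtain ⟨hSC, hTC⟩ := (hle C hC).1 hτ
      rw [hsum, hD.rayGens_coneOf hC] at hA'
      -- Every generator allowed in the star subdivision is an indicator, so `A'` comes from a
      -- subfamily of `insert V C`.
      have himage : ind '' (((insert V C).filter fun R => ind R ∈ A' : Finset (Finset (Fin n))) :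
          Set (Finset (Fin n))) = A' := by
        ext v
        constructor
        · rintro ⟨R, hR, rfl⟩
          exact (Finset.mem_filter.1 hR).2
        · intro hv
          rcases hA' hv with ⟨R, hR, rfl⟩ | rfl
          · exact ⟨R, Finset.mem_filter.2 ⟨Finset.mem_insert_of_mem hR, hv⟩, rfl⟩
          · exact ⟨V, Finset.mem_filter.2 ⟨Finset.mem_insert_self _ _, hv⟩, rfl⟩
      refine ⟨(insert V C).filter fun R => ind R ∈ A',
        ⟨fun hcon => hnot ?_, Or.inr ⟨C, hC, hSC, hTC, Finset.filter_subset _ _⟩⟩, ?_⟩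
      · rw [hrays, Set.insert_subset_iff, Set.singleton_subset_iff]
        exact ⟨(Finset.mem_filter.1 hcon.1).2, (Finset.mem_filter.1 hcon.2).2⟩
      · rw [coneOf, himage]

/-- The measure for termination: old vertices survive and `V` is new. -/
theorem ncard_vertices_lt (hD : IsCoarse D) {A₀ : Finset (Finset (Fin n))} (hA₀ : A₀ ∈ D)
    {S T V : Finset (Fin n)} (hS : S ∈ A₀) (hT : T ∈ A₀) (hST : S ≠ T)
    (hind : ind V = ind S + ind T) :
    {R | {R} ∈ D}.ncard < {R | {R} ∈ BraidFan.starComplex D S T V}.ncard := by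
  have hnot : ∀ R, ¬(S ∈ ({R} : Finset (Finset (Fin n))) ∧ T ∈ ({R} : Finset (Finset (Fin n)))) :=
    fun R h => hST ((Finset.mem_singleton.1 h.1).trans (Finset.mem_singleton.1 h.2).symm)
  have hsub : {R | {R} ∈ D} ⊆ {R | {R} ∈ BraidFan.starComplex D S T V} :=
    fun R hR => ⟨hnot R, Or.inl hR⟩
  refine Set.ncard_lt_ncard ((Set.ssubset_iff_of_subset hsub).2
    ⟨V, ⟨hnot V, Or.inr ⟨A₀, hA₀, hS, hT, by simp⟩⟩, fun h => ?_⟩) (Set.toFinite _)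
  exact hD.notMem_of_ind_eq_add hA₀ hS hT hST hind h (Finset.mem_singleton_self V)

end IsCoarse

/-! ### Cones labeled by stars with two leaves -/

/-- The leaves are the complements of `S` and `T`, the center is `S ∩ T`; the coefficients are the
increments from leaf to center. -/
theorem isStarLabeled_of_cover {S T : Finset (Fin n)} (hS : IsProper S) (hT : IsProper T)
    (hcover : ∀ i, i ∈ S ∨ i ∈ T) (hV : (S ∩ T).Nonempty) : IsStarLabeled (coneOf {S, T}) := by
  obtain ⟨-, p, hp⟩ := hS
  obtain ⟨-, q, hq⟩ := hT
  obtain ⟨b, hb⟩ := id hV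
  obtain ⟨hbS, hbT⟩ := Finset.mem_inter.1 hb
  refine ⟨2, ![Sᶜ, Tᶜ], S ∩ T, le_rfl, ⟨?_, hV, ?_, ?_, ?_⟩, Or.inl ?_⟩
  · simp only [Fin.forall_fin_two]
    exact ⟨⟨p, by simpa using hp⟩, ⟨q, by simpa using hq⟩⟩
  · have h : Disjoint Sᶜ Tᶜ := Finset.disjoint_left.2 fun i h1 h2 => by
      have := hcover i
      simp_all
    simp [Fin.forall_fin_two, h, h.symm]
  · simp only [Fin.forall_fin_two, Finset.disjoint_left]
    constructor <;> intro i h <;> simp_all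
  · intro i
    simp only [Fin.exists_fin_two, Finset.mem_inter]
    simp
    tauto
  · apply le_antisymm
    · rw [coneOf_le]
      simp only [Finset.mem_insert, Finset.mem_singleton, forall_eq_or_imp, forall_eq]
      constructor
      all_goals
        refine (toNR_mem_preposetCone _ _).2 fun i j hij => ?_
        have h1 := hcover i
        have h2 := hcover j
        simp only [starPreposet, Fin.exists_fin_two, Finset.mem_inter, Matrix.cons_val_zero,
          Matrix.cons_val_one, Finset.mem_compl] at hij
        split_ifs <;> first | (exfalso; tauto) | norm_num
    · intro x hx
      induction x using Submodule.Quotient.induction_on with | _ x => ?_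
      have hx := (toNR_mem_preposetCone _ x).1 hx
      simp only [starPreposet, Fin.exists_fin_two, Finset.mem_inter, Matrix.cons_val_zero,
        Matrix.cons_val_one, Finset.mem_compl] at hx
      have hpb := hx p b (Or.inr (Or.inl ⟨hp, Or.inr ⟨hbS, hbT⟩⟩))
      have hqb := hx q b (Or.inr (Or.inr ⟨hq, Or.inr ⟨hbS, hbT⟩⟩))
      have hval : ∀ i, x i = (x b - x p) * (if i ∈ S then 1 else 0) +
          (x b - x q) * (if i ∈ T then 1 else 0) + (x p + x q - x b) := by
        intro i
        by_cases h1 : i ∈ S <;> by_cases h2 : i ∈ T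
        · have := hx i b (Or.inl ⟨⟨h1, h2⟩, hbS, hbT⟩)
          have := hx b i (Or.inl ⟨⟨hbS, hbT⟩, h1, h2⟩)
          simp only [h1, h2, if_true]; linarith
        · have := hx i q (Or.inr (Or.inr ⟨h2, Or.inl hq⟩))
          have := hx q i (Or.inr (Or.inr ⟨hq, Or.inl h2⟩))
          simp only [h1, h2, if_true, if_false]; linarith
        · have := hx i p (Or.inr (Or.inl ⟨h1, Or.inl hp⟩))
          have := hx p i (Or.inr (Or.inl ⟨hp, Or.inl h1⟩))
          simp only [h1, h2, if_true, if_false]; linarith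
        · exact ((hcover i).elim h1 h2).elim
      have hx' : toNR x = (x b - x p) • ind S + (x b - x q) • ind T := by
        refine eq_of_coordDiff_eq fun i j => ?_
        rw [map_add, map_smul, map_smul, coordDiff_toNR, coordDiff_ind, coordDiff_ind, hval i,
          hval j, smul_eq_mul, smul_eq_mul]
        ring
      change toNR x ∈ _
      rw [hx']
      exact add_mem (PointedCone.smul_mem _ (sub_nonneg.2 hpb) (ind_mem_coneOf (by simp)))
        (PointedCone.smul_mem _ (sub_nonneg.2 hqb) (ind_mem_coneOf (by simp)))

/-- The leaves are `S` and `T`, the center is the complement of their union, and the star is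
reversed. -/
theorem isStarLabeled_of_disjoint {S T : Finset (Fin n)} (hS : IsProper S) (hT : IsProper T)
    (hdisj : ∀ i, i ∈ S → i ∉ T) (hV : ∃ b, b ∉ S ∪ T) : IsStarLabeled (coneOf {S, T}) := by
  obtain ⟨⟨p, hp⟩, -⟩ := hS
  obtain ⟨⟨q, hq⟩, -⟩ := hT
  obtain ⟨b, hb⟩ := hV
  obtain ⟨hbS, hbT⟩ := not_or.1 fun h => hb (Finset.mem_union.2 h)
  refine ⟨2, ![S, T], (S ∪ T)ᶜ, le_rfl, ⟨?_, ⟨b, by simpa using hb⟩, ?_, ?_, ?_⟩, Or.inr ?_⟩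
  · simp only [Fin.forall_fin_two]
    exact ⟨⟨p, hp⟩, ⟨q, hq⟩⟩
  · have h : Disjoint S T := Finset.disjoint_left.2 hdisj
    simp [Fin.forall_fin_two, h, h.symm]
  · simp only [Fin.forall_fin_two, Finset.disjoint_left]
    constructor <;> intro i h <;> simp_all
  · intro i
    simp only [Fin.exists_fin_two, Finset.mem_compl, Finset.mem_union]
    simp
    tauto
  · apply le_antisymm
    · rw [coneOf_le]
      simp only [Finset.mem_insert, Finset.mem_singleton, forall_eq_or_imp, forall_eq]
      constructor
      all_goals
        refine (toNR_mem_preposetCone _ _).2 fun i j hij => ?_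
        have h1 := hdisj i
        have h2 := hdisj j
        simp only [starPreposet, Fin.exists_fin_two, Finset.mem_union, Matrix.cons_val_zero,
          Matrix.cons_val_one, Finset.mem_compl] at hij
        split_ifs <;> first | (exfalso; tauto) | norm_num
    · intro x hx
      induction x using Submodule.Quotient.induction_on with | _ x => ?_
      have hx := (toNR_mem_preposetCone _ x).1 hx
      simp only [starPreposet, Fin.exists_fin_two, Finset.mem_union, Matrix.cons_val_zero,
        Matrix.cons_val_one, Finset.mem_compl] at hx
      have hpb := hx b p (Or.inr (Or.inl ⟨hp, Or.inr (not_or.2 ⟨hbS, hbT⟩)⟩))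
      have hqb := hx b q (Or.inr (Or.inr ⟨hq, Or.inr (not_or.2 ⟨hbS, hbT⟩)⟩))
      have hval : ∀ i, x i = (x p - x b) * (if i ∈ S then 1 else 0) +
          (x q - x b) * (if i ∈ T then 1 else 0) + x b := by
        intro i
        by_cases h1 : i ∈ S <;> by_cases h2 : i ∈ T
        · exact (hdisj i h1 h2).elim
        · have := hx i p (Or.inr (Or.inl ⟨hp, Or.inl h1⟩))
          have := hx p i (Or.inr (Or.inl ⟨h1, Or.inl hp⟩))
          simp only [h1, h2, if_true, if_false]; linarith
        · have := hx i q (Or.inr (Or.inr ⟨hq, Or.inl h2⟩))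
          have := hx q i (Or.inr (Or.inr ⟨h2, Or.inl hq⟩))
          simp only [h1, h2, if_true, if_false]; linarith
        · have := hx i b (Or.inl ⟨not_or.2 ⟨hbS, hbT⟩, not_or.2 ⟨h1, h2⟩⟩)
          have := hx b i (Or.inl ⟨not_or.2 ⟨h1, h2⟩, not_or.2 ⟨hbS, hbT⟩⟩)
          simp only [h1, h2, if_false]; linarith
      have hx' : toNR x = (x p - x b) • ind S + (x q - x b) • ind T := by
        refine eq_of_coordDiff_eq fun i j => ?_
        rw [map_add, map_smul, map_smul, coordDiff_toNR, coordDiff_ind, coordDiff_ind, hval i,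
          hval j, smul_eq_mul, smul_eq_mul]
        ring
      change toNR x ∈ _
      rw [hx']
      exact add_mem (PointedCone.smul_mem _ (sub_nonneg.2 hpb) (ind_mem_coneOf (by simp)))
        (PointedCone.smul_mem _ (sub_nonneg.2 hqb) (ind_mem_coneOf (by simp)))

/-! ### The choice of the star -/

namespace IsCoarse

variable {D : Set (Finset (Finset (Fin n)))}

/-- If the dual coordinates of `S` and `T` are differences that share an endpoint, then each chamber
of the cone lies on one side of the subdivision. -/
theorem chamber_le_of_dual {A : Finset (Finset (Fin n))} {S T V : Finset (Fin n)} (hS : S ∈ A)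
    (hT : T ∈ A) (hST : S ≠ T) (hSV : S ≠ V) (hTV : T ≠ V) (hind : ind V = ind S + ind T)
    {a b c d : Fin n} (ha : a ∉ S) (hb : b ∈ S) (hab : ∀ R ∈ A, R ≠ S → (a ∈ R ↔ b ∈ R))
    (hc : c ∉ T) (hd : d ∈ T) (hcd : ∀ R ∈ A, R ≠ T → (c ∈ R ↔ d ∈ R)) (h : b = d ∨ a = c)
    {w : Equiv.Perm (Fin n)} (hw : weylChamber w ≤ coneOf A) :
    weylChamber w ≤ coneOf (insert V (A.erase S)) ∨
      weylChamber w ≤ coneOf (insert V (A.erase T)) := by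
  -- The shared endpoint cancels, so the difference of the two coefficients is a single coordinate
  -- difference, of constant sign on each chamber.
  obtain ⟨p, q, hpq⟩ : ∃ p q, ∀ x : NR n,
      coordDiff a b x - coordDiff c d x = coordDiff p q x := by
    rcases h with rfl | rfl
    · exact ⟨a, c, fun x => by rw [← coordDiff_add_coordDiff a c b]; ring⟩
    · exact ⟨d, b, fun x => by rw [← coordDiff_add_coordDiff a d b]; ring⟩
  have hdiff : ∀ f, IsCoeff A f → f S - f T = coordDiff p q (comb f) := fun f hf => by
    rw [← hpq, coordDiff_comb_of_dual ha hb hab hf.eq_zero,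
      coordDiff_comb_of_dual hc hd hcd hf.eq_zero]
  rcases le_total (w p) (w q) with h | h
  · refine Or.inr fun x hx => ?_
    obtain ⟨f, hf, rfl⟩ := mem_coneOf.1 (hw hx)
    refine comb_mem_coneOf_insert_erase hS hST hTV hind hf ?_
    have := hx p q h
    rw [← hdiff f hf] at this
    linarith
  · refine Or.inl fun x hx => ?_
    obtain ⟨f, hf, rfl⟩ := mem_coneOf.1 (hw hx)
    refine comb_mem_coneOf_insert_erase hT hST.symm hSV (by rw [hind, add_comm]) hf ?_
    have := hx q p h
    rw [coordDiff_swap, ← hdiff f hf] at this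
    linarith

/-- By `cross_free`, `R` together with `S` covers `[n]` and `R ⊆ T`. As `R` misses `d`, the covering
pair `R`, `S` has a smaller intersection. -/
theorem false_of_separating_cover (hD : IsCoarse D) {A : Finset (Finset (Fin n))} (hA : A ∈ D)
    {S T R : Finset (Fin n)} (hS : S ∈ A) (hT : T ∈ A) (hR : R ∈ A)
    (hmin : ∀ Q ∈ A, ∀ R ∈ A, (∀ i, i ∈ Q ∨ i ∈ R) → (S ∩ T).card ≤ (Q ∩ R).card)
    {a b c d : Fin n} (ha : a ∉ S) (hb : b ∈ S ∧ b ∈ T) (hc : c ∉ T) (hd : d ∈ S ∧ d ∈ T)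
    (haR : a ∈ R) (hbR : b ∈ R) (hcR : c ∉ R) (hdR : d ∉ R) : False := by
  have hRS : ∀ i, i ∈ R ∨ i ∈ S := by
    rcases hD.cross_free hA hR hS with h | h | h | h
    exacts [(ha (h haR)).elim, (hdR (h hd.1)).elim, (h b hbR hb.1).elim, h]
  have hRT : R ⊆ T := by
    rcases hD.cross_free hA hR hT with h | h | h | h
    exacts [h, (hdR (h hd.2)).elim, (h b hbR hb.2).elim, ((h c).elim hcR hc).elim]
  refine (hmin R hR S hS hRS).not_gt (Finset.card_lt_card
    ((Finset.ssubset_iff_of_subset fun i hi => ?_).2 ⟨d, Finset.mem_inter.2 hd, fun h => ?_⟩))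
  · rw [Finset.mem_inter] at hi ⊢
    exact ⟨hi.2, hRT hi.1⟩
  · exact hdR (Finset.mem_inter.1 h).1

/-- By `cross_free`, `R` contains `S` and is disjoint from `T`. As `R` contains `a`, the disjoint
pair `R`, `T` has a larger union. -/
theorem false_of_separating_disjoint (hD : IsCoarse D) {A : Finset (Finset (Fin n))} (hA : A ∈ D)
    {S T R : Finset (Fin n)} (hS : S ∈ A) (hT : T ∈ A) (hR : R ∈ A)
    (hmax : ∀ Q ∈ A, ∀ R ∈ A, (∀ i, i ∈ Q → i ∉ R) → (Q ∪ R).card ≤ (S ∪ T).card)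
    {a b c d : Fin n} (ha : a ∉ S ∧ a ∉ T) (hb : b ∈ S) (hc : c ∉ S ∧ c ∉ T) (hd : d ∈ T)
    (haR : a ∈ R) (hbR : b ∈ R) (hcR : c ∉ R) (hdR : d ∉ R) : False := by
  have hSR : S ⊆ R := by
    rcases hD.cross_free hA hR hS with h | h | h | h
    exacts [(ha.1 (h haR)).elim, h, (h b hbR hb).elim, ((h c).elim hcR hc.1).elim]
  have hRT : ∀ i, i ∈ R → i ∉ T := by
    rcases hD.cross_free hA hR hT with h | h | h | h
    exacts [(ha.2 (h haR)).elim, (hdR (h hd)).elim, h, ((h c).elim hcR hc.2).elim]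
  refine (hmax R hR T hT hRT).not_gt (Finset.card_lt_card ((Finset.ssubset_iff_of_subset
    (Finset.union_subset_union_left hSR)).2 ⟨a, Finset.mem_union_left _ haR, fun h => ?_⟩))
  exact (Finset.mem_union.1 h).elim ha.1 ha.2

/-- Complementary sets have opposite indicators, which would span a line. -/
theorem not_complementary (hD : IsCoarse D) {A : Finset (Finset (Fin n))} (hA : A ∈ D)
    {S T : Finset (Fin n)} (hS : S ∈ A) (hT : T ∈ A) (hcover : ∀ i, i ∈ S ∨ i ∈ T)
    (hdisj : ∀ i, i ∈ S → i ∉ T) : False := by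
  have h : -ind S = ind T := by
    refine eq_of_coordDiff_eq fun i j => ?_
    have key : ∀ i, (if i ∈ T then (1 : ℝ) else 0) = 1 - if i ∈ S then 1 else 0 := fun i => by
      have := hcover i
      have := hdisj i
      split_ifs <;> first | (exfalso; tauto) | norm_num
    rw [map_neg, coordDiff_ind, coordDiff_ind, key i, key j]
    ring
  exact (hD.proper A hA S hS).ind_ne_zero
    (hD.stronglyConvex hA _ (ind_mem_coneOf hS) (h ▸ ind_mem_coneOf hT))

theorem exists_star_of_cover (hD : IsCoarse D) {A : Finset (Finset (Fin n))} (hA : A ∈ D)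
    {S T : Finset (Fin n)} (hS : S ∈ A) (hT : T ∈ A) (hcover : ∀ i, i ∈ S ∨ i ∈ T) :
    ∃ A ∈ D, ∃ S ∈ A, ∃ T ∈ A, ∃ V, S ≠ T ∧ ind V = ind S + ind T ∧
      IsStarLabeled (coneOf {S, T}) ∧ IsCoarse (BraidFan.starComplex D S T V) := by
  -- The minimum runs over all faces of `D`, since every cone containing both `S` and `T` is
  -- subdivided.
  obtain ⟨⟨S, T⟩, ⟨A, hA, hS, hT, hcover⟩, hmin⟩ := Set.exists_min_image
    {p : Finset (Fin n) × Finset (Fin n) | ∃ A ∈ D, p.1 ∈ A ∧ p.2 ∈ A ∧ ∀ i, i ∈ p.1 ∨ i ∈ p.2}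
    (fun p => (p.1 ∩ p.2).card) (Set.toFinite _) ⟨(S, T), A, hA, hS, hT, hcover⟩
  dsimp only at hS hT hcover
  have hSp := hD.proper A hA S hS
  have hTp := hD.proper A hA T hT
  have hST : S ≠ T := by
    rintro rfl
    obtain ⟨-, i, hi⟩ := hSp
    exact (hcover i).elim hi hi
  have hV : (S ∩ T).Nonempty := by
    by_contra h
    refine hD.not_complementary hA hS hT hcover fun i h1 h2 => h ⟨i, Finset.mem_inter.2 ⟨h1, h2⟩⟩
  have hind : ind (S ∩ T) = ind S + ind T := by
    refine eq_of_coordDiff_eq fun i j => ?_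
    have key : ∀ i, (if i ∈ S ∩ T then (1 : ℝ) else 0) =
        (if i ∈ S then 1 else 0) + (if i ∈ T then 1 else 0) - 1 := fun i => by
      have := hcover i
      simp only [Finset.mem_inter]
      by_cases h1 : i ∈ S <;> by_cases h2 : i ∈ T <;> simp_all
    rw [map_add, coordDiff_ind, coordDiff_ind, coordDiff_ind, key i, key j]
    ring
  refine ⟨A, hA, S, hS, T, hT, S ∩ T, hST, hind, isStarLabeled_of_cover hSp hTp hcover hV,
    hD.starComplex hA hS hT hST ⟨hV, ?_⟩ hind ?_⟩
  · obtain ⟨-, i, hi⟩ := hSp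
    exact ⟨i, fun h => hi (Finset.mem_inter.1 h).1⟩
  intro B hB hSB hTB w hw
  obtain ⟨a, b, ha, hb, hab⟩ := hD.exists_dual hB hw hSB
  obtain ⟨c, d, hc, hd, hcd⟩ := hD.exists_dual hB hw hTB
  have hVB := fun {A} => hD.notMem_of_ind_eq_add hA hS hT hST hind (A := A)
  refine chamber_le_of_dual hSB hTB hST (fun h => hVB hB (by rwa [← h]))
    (fun h => hVB hB (by rwa [← h])) hind ha hb hab hc hd hcd (Or.inl ?_) hw
  -- Since `S` and `T` cover, `a ∈ T`, and `T` does not separate `a` from `b`. So `b` and, likewise,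
  -- `d` lie in `S ∩ T`; a set separating them would contradict minimality.
  have hbT : b ∈ T := (hab T hTB hST.symm).1 ((hcover a).resolve_left ha)
  have hdS : d ∈ S := (hcd S hSB hST).1 ((hcover c).resolve_right hc)
  have hmin' : ∀ Q ∈ B, ∀ R ∈ B, (∀ i, i ∈ Q ∨ i ∈ R) → (S ∩ T).card ≤ (Q ∩ R).card :=
    fun Q hQ R hR h => hmin (Q, R) ⟨B, hB, hQ, hR, h⟩
  by_contra hbd
  obtain ⟨R, hR, hRbd⟩ := exists_separating hw hbd
  have hRS : R ≠ S := by rintro rfl; tauto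
  have hRT : R ≠ T := by rintro rfl; tauto
  have h1 := hab R hR hRS
  have h2 := hcd R hR hRT
  by_cases hbR : b ∈ R
  · exact hD.false_of_separating_cover hB hSB hTB hR hmin' ha ⟨hb, hbT⟩ hc ⟨hdS, hd⟩
      (by tauto) hbR (by tauto) (by tauto)
  · refine hD.false_of_separating_cover hB hTB hSB hR (fun Q hQ R hR h => ?_) hc ⟨hd, hdS⟩ ha
      ⟨hbT, hb⟩ (by tauto) (by tauto) (by tauto) hbR
    rw [Finset.inter_comm]
    exact hmin' Q hQ R hR h

theorem exists_star_of_disjoint (hD : IsCoarse D) {A : Finset (Finset (Fin n))} (hA : A ∈ D)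
    {S T : Finset (Fin n)} (hS : S ∈ A) (hT : T ∈ A) (hdisj : ∀ i, i ∈ S → i ∉ T) :
    ∃ A ∈ D, ∃ S ∈ A, ∃ T ∈ A, ∃ V, S ≠ T ∧ ind V = ind S + ind T ∧
      IsStarLabeled (coneOf {S, T}) ∧ IsCoarse (BraidFan.starComplex D S T V) := by
  obtain ⟨⟨S, T⟩, ⟨A, hA, hS, hT, hdisj⟩, hmax⟩ := Set.exists_max_image
    {p : Finset (Fin n) × Finset (Fin n) | ∃ A ∈ D, p.1 ∈ A ∧ p.2 ∈ A ∧ ∀ i, i ∈ p.1 → i ∉ p.2}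
    (fun p => (p.1 ∪ p.2).card) (Set.toFinite _) ⟨(S, T), A, hA, hS, hT, hdisj⟩
  dsimp only at hS hT hdisj
  have hSp := hD.proper A hA S hS
  have hTp := hD.proper A hA T hT
  have hST : S ≠ T := by
    rintro rfl
    obtain ⟨⟨i, hi⟩, -⟩ := hSp
    exact hdisj i hi hi
  have hV : ∃ i, i ∉ S ∪ T := by
    by_contra! h
    exact hD.not_complementary hA hS hT (fun i => Finset.mem_union.1 (h i)) hdisj
  have hind : ind (S ∪ T) = ind S + ind T := by
    refine eq_of_coordDiff_eq fun i j => ?_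
    have key : ∀ i, (if i ∈ S ∪ T then (1 : ℝ) else 0) =
        (if i ∈ S then 1 else 0) + (if i ∈ T then 1 else 0) := fun i => by
      have := hdisj i
      simp only [Finset.mem_union]
      by_cases h1 : i ∈ S <;> by_cases h2 : i ∈ T <;> simp_all
    rw [map_add, coordDiff_ind, coordDiff_ind, coordDiff_ind, key i, key j]
    ring
  refine ⟨A, hA, S, hS, T, hT, S ∪ T, hST, hind, isStarLabeled_of_disjoint hSp hTp hdisj hV,
    hD.starComplex hA hS hT hST ⟨?_, hV⟩ hind ?_⟩
  · obtain ⟨⟨i, hi⟩, -⟩ := hSp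
    exact ⟨i, Finset.mem_union_left _ hi⟩
  intro B hB hSB hTB w hw
  obtain ⟨a, b, ha, hb, hab⟩ := hD.exists_dual hB hw hSB
  obtain ⟨c, d, hc, hd, hcd⟩ := hD.exists_dual hB hw hTB
  have hVB := fun {A} => hD.notMem_of_ind_eq_add hA hS hT hST hind (A := A)
  refine chamber_le_of_dual hSB hTB hST (fun h => hVB hB (by rwa [← h]))
    (fun h => hVB hB (by rwa [← h])) hind ha hb hab hc hd hcd (Or.inr ?_) hw
  -- Here it is the lower endpoints `a` and `c` that lie outside `S ∪ T` and must coincide.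
  have haT : a ∉ T := fun h => hdisj b hb ((hab T hTB hST.symm).1 h)
  have hcS : c ∉ S := fun h => hdisj d ((hcd S hSB hST).1 h) hd
  have hmax' : ∀ Q ∈ B, ∀ R ∈ B, (∀ i, i ∈ Q → i ∉ R) → (Q ∪ R).card ≤ (S ∪ T).card :=
    fun Q hQ R hR h => hmax (Q, R) ⟨B, hB, hQ, hR, h⟩
  by_contra hac
  obtain ⟨R, hR, hRac⟩ := exists_separating hw hac
  have hRS : R ≠ S := by rintro rfl; tauto
  have hRT : R ≠ T := by rintro rfl; tauto
  have h1 := hab R hR hRS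
  have h2 := hcd R hR hRT
  by_cases haR : a ∈ R
  · exact hD.false_of_separating_disjoint hB hSB hTB hR hmax' ⟨ha, haT⟩ hb ⟨hcS, hc⟩ hd
      haR (by tauto) (by tauto) (by tauto)
  · refine hD.false_of_separating_disjoint hB hTB hSB hR (fun Q hQ R hR h => ?_) ⟨hc, hcS⟩ hd
      ⟨haT, ha⟩ hb (by tauto) (by tauto) haR (by tauto)
    rw [Finset.union_comm T S]
    exact hmax' Q hQ R hR h

/-! ### Complexes of chains -/

/-- A chamber containing the sum of a chain contains each member: if `i ∈ S` and `j ∉ S`, no member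
of the chain has `j` without `i`, so nothing offsets the strict inequality from `S`. -/
theorem le_weylChamber_of_chain {A : Finset (Finset (Fin n))}
    (hchain : ∀ S ∈ A, ∀ T ∈ A, S ⊆ T ∨ T ⊆ S) : ∃ w, coneOf A ≤ weylChamber w := by
  obtain ⟨w, hw⟩ := exists_mem_weylChamber (∑ R ∈ A, ind R)
  refine ⟨w, coneOf_le.2 fun S hS i j hij => ?_⟩
  have h := hw i j hij
  rw [coordDiff_ind]
  by_cases hj : j ∈ S
  · simp only [hj, if_true]; split_ifs <;> norm_num
  by_cases hi : i ∈ S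
  · exfalso
    rw [map_sum] at h
    refine h.not_gt (Finset.sum_neg' (fun R hR => ?_) ⟨S, hS, ?_⟩)
    · rw [coordDiff_ind]
      by_cases hjR : j ∈ R
      · have : i ∈ R := (hchain R hR S hS).elim (fun h => (hj (h hjR)).elim) fun h => h hi
        simp [this, hjR]
      · simp only [hjR, if_false]; split_ifs <;> norm_num
    · simp [coordDiff_ind, hi, hj]
  · simp [hi, hj]

/-- A point of the chamber with distinct coordinates determines the linear order. -/
theorem weylChamber_eq_of_le {w w' : Equiv.Perm (Fin n)} (h : weylChamber w ≤ weylChamber w') :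
    weylChamber w = weylChamber w' := by
  have hx : toNR (fun i => ((w i : ℕ) : ℝ)) ∈ weylChamber w :=
    (toNR_mem_preposetCone _ _).2 fun i j hij => by exact_mod_cast hij
  have h1 : ∀ i j, w' i ≤ w' j → w i ≤ w j := fun i j hij => by
    exact_mod_cast (toNR_mem_preposetCone _ _).1 (h hx) i j hij
  refine le_antisymm h fun x hx i j hij => hx i j ?_
  by_contra! hlt
  have := w.injective (le_antisymm hij (h1 j i hlt.le))
  subst this
  exact lt_irrefl _ hlt

theorem fanOf_eq_braidFan (hD : IsCoarse D)
    (hchain : ∀ A ∈ D, ∀ S ∈ A, ∀ T ∈ A, S ⊆ T ∨ T ⊆ S) : fanOf D = braidFan n := by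
  have hmem : ∀ w, ∃ A ∈ D, coneOf A = weylChamber w := by
    intro w
    obtain ⟨A, hA, hle⟩ := hD.chamber_le w
    obtain ⟨w', hw'⟩ := le_weylChamber_of_chain (hchain A hA)
    have := weylChamber_eq_of_le (hle.trans hw')
    exact ⟨A, hA, le_antisymm (hw'.trans this.ge) hle⟩
  ext σ
  constructor
  · rintro ⟨A, hA, rfl⟩
    obtain ⟨w, hw⟩ := le_weylChamber_of_chain (hchain A hA)
    obtain ⟨B, hB, hBw⟩ := hmem w
    refine ⟨w, ?_⟩
    rw [← hBw] at hw ⊢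
    exact hD.isFaceOf hB ((hD.coneOf_le_coneOf hA hB).1 hw)
  · rintro ⟨w, hw⟩
    obtain ⟨A, hA, hAw⟩ := hmem w
    exact hD.isFan.face_mem _ ⟨A, hA, rfl⟩ σ (hAw ▸ hw)

/-- Star subdivisions at two-dimensional star-labeled cones lead to the braid arrangement fan. -/
theorem exists_star_sequence (hD : IsCoarse D) :
    ∃ (ℓ : ℕ) (E : ℕ → Set (Finset (Finset (Fin n)))), E 0 = D ∧ fanOf (E ℓ) = braidFan n ∧
      (∀ i ≤ ℓ, IsCoarse (E i)) ∧
      ∀ i < ℓ, ∃ τ ∈ fanOf (E i), IsStarLabeled τ ∧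
        fanOf (E (i + 1)) = starSubdivision (fanOf (E i)) τ := by
  -- Induction on the number of subsets of `[n]` that are not yet vertices.
  induction hk : (Set.univ : Set (Finset (Fin n))).ncard - {R | {R} ∈ D}.ncard
    using Nat.strong_induction_on generalizing D with
  | _ k ih => ?_
  by_cases hchain : ∀ A ∈ D, ∀ S ∈ A, ∀ T ∈ A, S ⊆ T ∨ T ⊆ S
  · exact ⟨0, fun _ => D, rfl, hD.fanOf_eq_braidFan hchain, fun _ _ => hD, by simp⟩
  push Not at hchain
  obtain ⟨A, hA, S, hS, T, hT, h1, h2⟩ := hchain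
  obtain ⟨A, hA, S, hS, T, hT, V, hST, hind, hlab, hD'⟩ :
      ∃ A ∈ D, ∃ S ∈ A, ∃ T ∈ A, ∃ V, S ≠ T ∧ ind V = ind S + ind T ∧
        IsStarLabeled (coneOf {S, T}) ∧ IsCoarse (BraidFan.starComplex D S T V) := by
    rcases hD.cross_free hA hS hT with h | h | h | h
    exacts [(h1 h).elim, (h2 h).elim, hD.exists_star_of_disjoint hA hS hT h,
      hD.exists_star_of_cover hA hS hT h]
  have hlt := hD.ncard_vertices_lt hA hS hT hST hind
  have hle : {R | {R} ∈ BraidFan.starComplex D S T V}.ncard ≤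
      (Set.univ : Set (Finset (Fin n))).ncard :=
    Set.ncard_le_ncard (Set.subset_univ _) (Set.toFinite _)
  obtain ⟨ℓ, E, h0, hℓ, hE, hstep⟩ := ih _ (by omega) hD' rfl
  refine ⟨ℓ + 1, fun i => Nat.casesOn i D E, rfl, hℓ, ?_, ?_⟩
  · rintro (_ | i) hi
    exacts [hD, hE i (by omega)]
  · rintro (_ | i) hi
    · refine ⟨coneOf {S, T}, ⟨{S, T}, hD.down_closed A hA _ ?_, rfl⟩, hlab, ?_⟩
      · simp [Finset.insert_subset_iff, hS, hT]
      · change fanOf (E 0) = _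
        rw [h0]
        exact hD.fanOf_starComplex hA hS hT hST hind hD'
    · exact hstep i (by omega)

end IsCoarse

end BraidFan

open BraidFan
theorem theorem3p1 (n : ℕ) (F : Set (Cone n)) (hfan : IsFan F) (hcomplete : IsCompleteFan F)
    (hsmooth : IsSmooth F) (hrefined : IsRefinedBy F (braidFan n)) :
    ∃ (ℓ : ℕ) (S : ℕ → Set (Cone n)),
      S 0 = F ∧ S ℓ = braidFan n ∧
      (∀ i ≤ ℓ, IsFan (S i) ∧ IsCompleteFan (S i) ∧ IsSmooth (S i) ∧
        IsRefinedBy (S i) (braidFan n)) ∧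
      ∀ i < ℓ, ∃ τ ∈ S i, IsStarLabeled τ ∧ S (i + 1) = starSubdivision (S i) τ := by
  obtain ⟨D, hD, rfl⟩ := exists_isCoarse hfan hsmooth hrefined.2
  obtain ⟨ℓ, E, h0, hℓ, hE, hstep⟩ := hD.exists_star_sequence
  exact ⟨ℓ, fun i => fanOf (E i), congrArg fanOf h0, hℓ, fun i hi => ⟨(hE i hi).isFan,
    (hE i hi).isCompleteFan, (hE i hi).isSmooth, (hE i hi).isRefinedBy⟩, hstep⟩
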